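/- **Setting.** Write $\|\cdot\|$ for the Euclidean norm. A feed-forward network is a composition $f_\theta=f^{(K)}_{\theta_K}\circ\dots\circ f^{(1)}_{\theta_1}$, $f^{(k)}_{\theta_k}:\mathbb R^{n_k}\to\mathbb R^{n_{k+1}}$, $\theta_k\in\mathbb R^{p_k}$, in which every layer is of one of the following types, with an associated bound $L_{x_k}$ on the Lipschitz constant in the input, a bound $L_{\theta_k}$ on the Lipschitz constant in the parameters, and a rule that turns a bound $X_k$ on the norm of its input into a bound $X_{k+1}$ on the norm of its output: * a *trainable layer* $x\mapsto f(\theta_k,x)$, with a seminorm $N_k$ on $\mathbb R^{p_k}$ (for example the spectral or the Frobenius norm) and a constant $\beta_k\ge 0$ ($0$ for operators without bias, $1$ for $Wx+B$) such that $\|f(\theta_k,x)\|\le N_k(\theta_k)\,\|(x,\beta_k)\|$; $f(\theta_k,\cdot)$ is $L_{x_k}(u)$-Lipschitz whenever $N_k(\theta_k)\le u$, and $f(\cdot,x)$ is $L_{\theta_k}(X)$-Lipschitz whenever $\|x\|\le X$, for measurable functions $L_{x_k},L_{\theta_k}:\mathbb R\to[0,\infty)$; rule: $X_{k+1}=u_k\sqrt{X_k^2+\beta_k^2}$;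 * an *activation layer*: a parameter-free $L_{x_k}$-Lipschitz map $f$; rule: $X_{k+1}=\|f(0)\|+L_{x_k}X_k$; * a *group normalization layer*, without parameters: each group of coordinates $v$ is mapped to $(v-\mu)/\max(\alpha,\varsigma)$, where $\mu$ is the mean of the entries of $v$, $\varsigma^2$ is their variance plus $\kappa$, and $\alpha>0$, $\kappa\ge0$; here $L_{x_k}=1/\alpha$ and $X_{k+1}=\min(\sqrt{n_{k+1}},X_k/\alpha)$. Layers without parameters have $p_k=0$ and $L_{\theta_k}=0$. Let $m$ be the number of layers with $p_k\neq 0$. The loss $\ell(\cdot,y)$ is $l$-Lipschitz for every label $y$. Instances are pairs $(x,y)$ with $\|x\|\le X_1$, datasets have $n$ instances, and two datasets are adjacent if they have the same size and differ in at most one element. A randomized algorithm $\mathcal A$ is $(\epsilon,\delta)$-DP if $P(\mathcal A(Z_1)\in S)\le e^{\epsilon}P(\mathcal A(Z_2)\in S)+\delta$ for all adjacent $Z_1,Z_2$ and all measurable $S$. **Algorithm (Lip-DP-SGD).** Inputs: a dataset $Z$ of size $n$, a number $T\ge0$ of iterations, a noise multiplier $\sigma>0$, a batch size $1\le s\le n$,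 learning rates $\eta(t)\in\mathbb R$, a maximal parameter norm $C>0$, and a data-independent initial distribution. Draw $\theta$ from the initial distribution and clip the weights: for every $k$ put $u_k=\min(C,N_k(\theta_k))$ and replace $\theta_k$ by $u_k\theta_k/N_k(\theta_k)$ (by $0$ if $N_k(\theta_k)=0$). Then, for $t=1,\dots,T$: 1. compute $X_2,\dots,X_K$ from $X_1$ and $u$ by the rules above (forward pass); put $l_{K+1}=l$, and for $k=K,\dots,1$ put $l_k=l_{k+1}L_{x_k}$ and $\Delta_k=l_{k+1}L_{\theta_k}$, with $L_{x_k}$ evaluated at $u_k$ and $L_{\theta_k}$ evaluated at $X_k$ (backward pass); 2. draw a batch $V\subseteq\{1,\dots,n\}$, including each index independently with probability $s/n$, and repeat this until $V\ne\emptyset$; 3. draw independent $b_k\sim\mathcal N(0,\sigma^2\Delta_k^2 I)$ and, simultaneously for all $k$, replace $\theta_k$ by $\theta_k-\eta(t)\frac1{|V|}\big(\sum_{i\in V}\nabla_{\theta_k}\ell(f_\theta(x_i),y_i)+b_k\big)$, where the gradient is taken to be $0$ at points where the loss is not differentiable in $\theta_k$; 4. clip the weights again. The output is $\theta$. **Accountant.**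 Put $r=4m/\sigma^2$. For $p\in[0,1]$ and an integer $a\ge2$ let $$A_a(p)=1+p^2\binom a2\min\{4(e^{r}-1),2e^{r}\}+\sum_{j=3}^{a}2p^j\binom aj e^{j(j-1)r/2},\qquad \rho_a=\min\Big\{\frac{a r}{2},\ \frac{\log \mathbb E[A_a(|V|/n)]}{a-1}\Big\},$$ where $V$ is distributed as the batch in step 2. **Theorem.** Lip-DP-SGD is differentially private, with the following explicit guarantees. 1. Its output is a well-defined random vector: for every dataset the output law is a probability measure. 2. For every integer $a\ge2$ and every $\delta\in(0,1)$, Lip-DP-SGD is $(\epsilon,\delta)$-DP with $\epsilon=T\rho_a+\dfrac{\log(1/\delta)}{a-1}$. 3. For every $\epsilon>0$ and $\delta\in(0,1)$, Lip-DP-SGD is $(\epsilon,\delta)$-DP as soon as $\sigma^2\ge \dfrac{8\,m\,T\,(\epsilon+\log(1/\delta))}{\epsilon^2}$. -/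

import Mathlib

open MeasureTheory ProbabilityTheory
open scoped NNReal ENNReal

noncomputable section

namespace LipDPSGD

/-- The Euclidean space `ℝⁿ` with the `2`-norm. -/
abbrev Vec (n : ℕ) : Type := EuclideanSpace ℝ (Fin n)

/-! ### Differential privacy -/

/-- Two datasets of the same size are adjacent if they differ in at most one element. -/
def Adjacent {n : ℕ} {𝒵 : Type*} (Z₁ Z₂ : Fin n → 𝒵) : Prop :=
  ∃ i, ∀ j, j ≠ i → Z₁ j = Z₂ j

/-- A randomized algorithm `M`, given by the law of its output on every dataset, is
`(ε, δ)`-differentially private. -/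
def IsDP {n : ℕ} {𝒵 : Type*} {𝒪 : Type*} [MeasurableSpace 𝒪]
    (M : (Fin n → 𝒵) → Measure 𝒪) (ε δ : ℝ) : Prop :=
  ∀ Z₁ Z₂ : Fin n → 𝒵, Adjacent Z₁ Z₂ → ∀ S : Set 𝒪, MeasurableSet S →
    M Z₁ S ≤ ENNReal.ofReal (Real.exp ε) * M Z₂ S + ENNReal.ofReal δ

/-! ### Layers of a feed-forward network -/

/-- A layer with trainable parameters (dense, convolutional, ...), `x ↦ f θ x`, with `θ ∈ ℝᵖ`.
`pnorm` is the norm in which the parameters are clipped (spectral norm, Frobenius norm, a scaled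
Euclidean norm for convolutions, ...).  `‖f θ x‖ ≤ pnorm θ * ‖(x, offset)‖`: for an operator
without bias `offset = 0` and `pnorm θ` bounds `‖f θ x‖ / ‖x‖`; for `W x + B`, which is the matrix
`(W, B)` applied to `(x, 1)`, `offset = 1`.
`lipInput u` is a Lipschitz bound in the input when `pnorm θ ≤ u`, and `lipParam X` is a Lipschitz
bound in the parameters when the input has norm at most `X`. -/
structure TrainableLayer (n m : ℕ) where
  p : ℕ
  f : Vec p → Vec n → Vec m
  pnorm : Seminorm ℝ (Vec p)
  offset : ℝ≥0
  lipInput : ℝ → ℝ≥0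
  lipParam : ℝ → ℝ≥0
  measurable_lipInput : Measurable lipInput
  measurable_lipParam : Measurable lipParam
  norm_le : ∀ θ x, ‖f θ x‖ ≤ pnorm θ * Real.sqrt (‖x‖ ^ 2 + (offset : ℝ) ^ 2)
  lipschitz_input : ∀ θ u, pnorm θ ≤ u → LipschitzWith (lipInput u) (f θ)
  lipschitz_param : ∀ x X, ‖x‖ ≤ X → LipschitzWith (lipParam X) (fun θ => f θ x)

/-- A Lipschitz layer without parameters, e.g. an activation layer. -/
structure ActivationLayer (n m : ℕ) where
  f : Vec n → Vec m
  lip : ℝ≥0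
  lipschitz : LipschitzWith lip f

/-- Data of a group normalization layer: `grp` is the partition of the components into groups,
`α` the threshold on the standard deviation and `κ` the small constant in its definition. -/
structure NormalizationLayer (n : ℕ) where
  G : ℕ
  grp : Fin n → Fin G
  α : ℝ
  κ : ℝ
  α_pos : 0 < α
  κ_nonneg : 0 ≤ κ

namespace NormalizationLayer

variable {n : ℕ} (L : NormalizationLayer n)

/-- The group of components that contains `j`. -/
def group (j : Fin n) : Finset (Fin n) := Finset.univ.filter (fun i => L.grp i = L.grp j)

/-- The mean of the group of `j`. -/
def mean (x : Vec n) (j : Fin n) : ℝ :=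
  (∑ i ∈ L.group j, x i) / ((L.group j).card : ℝ)

/-- The (regularized) standard deviation of the group of `j`. -/
def std (x : Vec n) (j : Fin n) : ℝ :=
  Real.sqrt ((∑ i ∈ L.group j, (x i - L.mean x j) ^ 2) / ((L.group j).card : ℝ) + L.κ)

/-- The normalization operation `x ↦ (x - μ) / max (α, σ)`, group by group. -/
def f (x : Vec n) : Vec n :=
  WithLp.toLp 2 (fun j => (x j - L.mean x j) / max L.α (L.std x j))

end NormalizationLayer

/-- The layers that a network may be composed of. -/
inductive Layer : ℕ → ℕ → Type
  | trainable {n m : ℕ} (L : TrainableLayer n m) : Layer n m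
  | activation {n m : ℕ} (L : ActivationLayer n m) : Layer n m
  | normalization {n : ℕ} (L : NormalizationLayer n) : Layer n n

namespace Layer

/-- The number of parameters of a layer. -/
def paramDim : {n m : ℕ} → Layer n m → ℕ
  | _, _, trainable L => L.p
  | _, _, activation _ => 0
  | _, _, normalization _ => 0

/-- The layer function. -/
def apply : {n m : ℕ} → (L : Layer n m) → Vec L.paramDim → Vec n → Vec m
  | _, _, trainable L => L.f
  | _, _, activation L => fun _ => L.f
  | _, _, normalization L => fun _ => L.f

/-- The norm used for the parameters of a layer (zero if there are none). -/
def pnorm : {n m : ℕ} → (L : Layer n m) → Vec L.paramDim → ℝ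
  | _, _, trainable L => L.pnorm
  | _, _, activation _ => fun _ => 0
  | _, _, normalization _ => fun _ => 0

/-- One step of the forward pass of `LayerSensitivity`: from a bound `X` on the norm of the input
of the layer, and a bound `u` on the norm of its parameters, to a bound on the norm of its output.
For a trainable layer with zero offset this is `X * u`, for an activation function vanishing at
`0` it is `X * lip`. -/
def nextBound : {n m : ℕ} → Layer n m → (u X : ℝ) → ℝ
  | _, _, trainable L => fun u X => Real.sqrt (X ^ 2 + (L.offset : ℝ) ^ 2) * u
  | _, _, activation L => fun _ X => ‖L.f 0‖ + X * L.lip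
  | n, _, normalization L => fun _ X => min (Real.sqrt n) (X / L.α)

/-- The upper bound on the Lipschitz value of the layer in its input. -/
def lipInput : {n m : ℕ} → Layer n m → (u : ℝ) → ℝ
  | _, _, trainable L => fun u => L.lipInput u
  | _, _, activation L => fun _ => L.lip
  | _, _, normalization L => fun _ => 1 / L.α

/-- The upper bound on the Lipschitz value of the layer in its parameters. -/
def lipParam : {n m : ℕ} → Layer n m → (X : ℝ) → ℝ
  | _, _, trainable L => fun X => L.lipParam X
  | _, _, activation _ => fun _ => 0
  | _, _, normalization _ => fun _ => 0

end Layer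

/-! ### Feed-forward networks -/

/-- A feed-forward network with `K` layers, the `k`-th one from `ℝ^(dim k)` to `ℝ^(dim (k+1))`
for `0 ≤ k < K`. -/
structure Network where
  K : ℕ
  dim : ℕ → ℕ
  layer : (k : Fin K) → Layer (dim k) (dim (k + 1))

namespace Network

variable (N : Network)

/-- The parameters `θ = (θ_k)_k` of the network. -/
abbrev Params : Type := (k : Fin N.K) → Vec (N.layer k).paramDim

/-- The output of the first `k` layers on the input `x`. -/
def act (θ : N.Params) (x : Vec (N.dim 0)) : (k : ℕ) → k ≤ N.K → Vec (N.dim k)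
  | 0, _ => x
  | k + 1, h => (N.layer ⟨k, h⟩).apply (θ ⟨k, h⟩) (act θ x k (Nat.le_of_succ_le h))

/-- The network function `f_θ`. -/
def eval (θ : N.Params) (x : Vec (N.dim 0)) : Vec (N.dim N.K) := N.act θ x N.K le_rfl

/-- The number of layers that have parameters. -/
def numTrainable : ℕ := (Finset.univ.filter (fun k => (N.layer k).paramDim ≠ 0)).card

/-- The gradient with respect to the parameters of layer `k` of the loss on the instance `(x, y)`
(`0` by convention at the exceptional points where the loss is not differentiable in them). -/
def lossGrad {Y : Type*} (ℓ : Vec (N.dim N.K) → Y → ℝ) (θ : N.Params)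
    (x : Vec (N.dim 0)) (y : Y) (k : Fin N.K) : Vec (N.layer k).paramDim :=
  gradient (fun w => ℓ (N.eval (Function.update θ k w) x) y) (θ k)

/-! ### Layer sensitivity -/

/-- Forward pass: the bound on the norm of the output of the first `k` layers, where `u` bounds
the norms of the parameters and `X₁` the norm of the input. -/
def inputBound (u : Fin N.K → ℝ) (X₁ : ℝ) : (k : ℕ) → k ≤ N.K → ℝ
  | 0, _ => X₁
  | k + 1, h => (N.layer ⟨k, h⟩).nextBound (u ⟨k, h⟩) (inputBound u X₁ k (Nat.le_of_succ_le h))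

/-- Backward pass: `backLip k` is the bound on the gradient of the loss with respect to the input
of layer `k`, and, for `k = K`, the Lipschitz bound `l` of the loss. -/
def backLip (u : Fin N.K → ℝ) (l : ℝ) (k : ℕ) : ℝ :=
  if h : k < N.K then backLip u l (k + 1) * (N.layer ⟨k, h⟩).lipInput (u ⟨k, h⟩) else l
termination_by N.K - k

/-- The sensitivities `Δ_k` computed by `LayerSensitivity`. -/
def layerSensitivity (u : Fin N.K → ℝ) (X₁ l : ℝ) (k : Fin N.K) : ℝ :=
  N.backLip u l (k + 1) * (N.layer k).lipParam (N.inputBound u X₁ k k.isLt.le)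

/-! ### The algorithm -/

/-- The norms `u_k = min (C, ‖θ_k‖)` returned by `ClipWeights`. -/
def clipNorms (C : ℝ) (θ : N.Params) (k : Fin N.K) : ℝ := min C ((N.layer k).pnorm (θ k))

/-- The parameters `u_k θ_k / ‖θ_k‖` returned by `ClipWeights`. -/
def clipParams (C : ℝ) (θ : N.Params) : N.Params :=
  fun k => (N.clipNorms C θ k / (N.layer k).pnorm (θ k)) • θ k

end Network

/-- The probability that the nonempty batch `V` is drawn: Poisson sampling, with every index
included independently with probability `q`, repeated until the batch is nonempty. -/
def batchProb (n : ℕ) (q : ℝ) (V : Finset (Fin n)) : ℝ :=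
  q ^ V.card * (1 - q) ^ (n - V.card) / (1 - (1 - q) ^ n)

/-- The nonempty batches. -/
def batches (n : ℕ) : Finset (Finset (Fin n)) := Finset.univ.filter (fun V => V.Nonempty)

/-- The instances `(x, y)` whose input satisfies `‖x‖ ≤ X₁`. -/
abbrev Instance (d : ℕ) (X₁ : ℝ) (Y : Type*) : Type _ := {x : Vec d // ‖x‖ ≤ X₁} × Y

namespace Network

variable (N : Network)

/-- The law of the noise `(b_k)_k`, with independent `b_k ∼ N(0, σ² Δ_k² I)`. -/
def noise (σ : ℝ) (Δ : Fin N.K → ℝ) : Measure N.Params :=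
  Measure.pi (fun k =>
    (stdGaussian (Vec (N.layer k).paramDim)).map (fun ξ => (σ * Δ k) • ξ))

/-- The gradient step with learning rate `lr`, batch `V` and noise `b`. -/
def update {Y : Type*} {X₁ : ℝ} {n : ℕ} (ℓ : Vec (N.dim N.K) → Y → ℝ) (lr : ℝ)
    (Z : Fin n → Instance (N.dim 0) X₁ Y) (θ : N.Params) (V : Finset (Fin n))
    (b : N.Params) : N.Params :=
  fun k => θ k - lr • ((1 / (V.card : ℝ)) •
    ((∑ i ∈ V, N.lossGrad ℓ θ (Z i).1.1 (Z i).2 k) + b k))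

/-- One iteration of Lip-DP-SGD on the dataset `Z`, started at `θ₀`: clip the weights, compute the
sensitivities, draw a batch (sampling rate `s / n`), draw the noise, and update all layers. -/
def step {Y : Type*} {X₁ : ℝ} {n : ℕ} (ℓ : Vec (N.dim N.K) → Y → ℝ) (l C σ s lr : ℝ)
    (Z : Fin n → Instance (N.dim 0) X₁ Y) (θ₀ : N.Params) : Measure N.Params :=
  ∑ V ∈ batches n, ENNReal.ofReal (batchProb n (s / n) V) •
    (N.noise σ (N.layerSensitivity (N.clipNorms C θ₀) X₁ l)).map
      (N.update ℓ lr Z (N.clipParams C θ₀) V)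

/-- The law of the parameters after `T` iterations, before the last call of `ClipWeights`. -/
def iterate {Y : Type*} {X₁ : ℝ} {n : ℕ} (ℓ : Vec (N.dim N.K) → Y → ℝ) (l C σ s : ℝ)
    (η : ℕ → ℝ) (init : Measure N.Params) (Z : Fin n → Instance (N.dim 0) X₁ Y) :
    ℕ → Measure N.Params
  | 0 => init
  | t + 1 => (iterate ℓ l C σ s η init Z t).bind (N.step ℓ l C σ s (η (t + 1)) Z)

/-- The law of the output of Lip-DP-SGD on the dataset `Z`, with initial distribution `init`,
`T` iterations, noise multiplier `σ`, batch size `s`, learning rates `η 1, ..., η T`, maximal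
parameter norm `C`, maximal input norm `X₁` and Lipschitz bound `l` of the loss `ℓ`.  Weights are
clipped after the initialization and after every iteration. -/
def lipDPSGD {Y : Type*} {X₁ : ℝ} {n : ℕ} (ℓ : Vec (N.dim N.K) → Y → ℝ) (l C σ s : ℝ)
    (η : ℕ → ℝ) (init : Measure N.Params) (T : ℕ) (Z : Fin n → Instance (N.dim 0) X₁ Y) :
    Measure N.Params :=
  (N.iterate ℓ l C σ s η init Z T).map (N.clipParams C)

end Network

/-! ### The privacy accountant -/

/-- The squared ratio between the sensitivity (`2 Δ_k` in each of `m` layers) and the standard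
deviation of the noise (`σ Δ_k` in each layer). -/
def gaussRatioSq (m : ℕ) (σ : ℝ) : ℝ := 4 * m / σ ^ 2

/-- Bound on the moment of order `a` of the privacy loss of a Gaussian mechanism with squared
sensitivity-to-noise ratio `r`, run on a random subset that contains a proportion `p` of
the data. -/
def subsampledMoment (r p : ℝ) (a : ℕ) : ℝ :=
  1 + p ^ 2 * (a.choose 2) * min (4 * (Real.exp r - 1)) (2 * Real.exp r)
    + ∑ j ∈ Finset.Icc 3 a, 2 * p ^ j * (a.choose j) * Real.exp (j * (j - 1) * r / 2)

/-- Rényi differential privacy of order `a` of one iteration: the minimum of the bound for the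
Gaussian mechanism and of the bound with amplification by Poisson subsampling at rate `s / n`. -/
def stepRDP (m n : ℕ) (σ s : ℝ) (a : ℕ) : ℝ :=
  min (a * gaussRatioSq m σ / 2)
    (Real.log (∑ V ∈ batches n, batchProb n (s / n) V *
      subsampledMoment (gaussRatioSq m σ) ((V.card : ℝ) / n) a) / ((a : ℝ) - 1))

/-- The value of `ε` that the Rényi accountant of order `a` returns for `T` iterations
and a given `δ`. -/
def accountant (m n T : ℕ) (σ s : ℝ) (a : ℕ) (δ : ℝ) : ℝ :=
  T * stepRDP m n σ s a + Real.log (1 / δ) / ((a : ℝ) - 1)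

end LipDPSGD

end

/-! Privacy loss is measured by the moment `∫ (dP/dQ)^a dQ` of order `a = b + 1`, where `P`, `Q` are
the output laws on two adjacent datasets (Rényi privacy). In the Hölder form of `MomentBound` no
densities are needed, and the calculus is short. Moments survive pushforwards, so updating and
clipping are free post-processing (`MomentBound.map`). They add over mixtures (`MomentBound.add`,
`MomentBound.smul`) and multiply under adaptive composition (`MomentBound.bind`). Testing against an
indicator gives the `(ε, δ)` statement (`MomentBound.measure_le`).

It remains to bound one iteration from a fixed `θ`. The clipping norms, hence the sensitivities
`Δ_k`, depend on `θ` and not on the data, so both datasets receive the same noise. Multiplying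
Lipschitz constants along the network bounds each per-instance gradient by `Δ_k`
(`norm_lossGrad_le`), so replacing one instance moves the gradient sum in layer `k` by at most `2
Δ_k`. In units of the noise `σ Δ_k`, the step is a post-processed standard Gaussian whose mean moves
by a squared distance of at most `r = 4m/σ²`. The explicit Gaussian moment gives the term `a r / 2`.

The amplified term pairs a batch `V` containing the changed index `i` with the batches in which `i`
is replaced by some `j` outside `V` (`sum_batches_eq`). Each pair is a mixture whose second
component is the same for both datasets, so three Gaussians with pairwise close means are compared
(`MomentBound.subsampled`). Expanding the mixture binomially, the first-order term integrates to
zero; this is why `A_a(p)` starts with `p²`.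

The third claim uses only the unamplified term and a good choice of the order (`exists_order`). -/

namespace LipDPSGD

/-! ### Bounds on the moments of the privacy loss -/

/-- `∫ (dP/dQ)^(b+1) dQ ≤ B`, expressed through Hölder's inequality, without densities. -/
def MomentBound {α : Type*} [MeasurableSpace α] (b : ℕ) (P Q : Measure α) (B : ℝ≥0∞) : Prop :=
  ∀ f : α → ℝ≥0∞, Measurable f →
    (∫⁻ x, f x ^ b ∂P) ^ (b + 1) ≤ (∫⁻ x, f x ^ (b + 1) ∂Q) ^ b * B

theorem _root_.ENNReal.pow_succ_le_pow_mul_iff (b : ℕ) (x y z : ℝ≥0∞) :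
    x ^ (b + 1) ≤ y ^ b * z ↔
      x ≤ y ^ ((b : ℝ) / (b + 1)) * z ^ (1 / ((b : ℝ) + 1)) := by
  have hb : (0 : ℝ) < (b : ℝ) + 1 := by positivity
  rw [← ENNReal.rpow_natCast x, ← ENNReal.rpow_natCast y]
  push_cast
  rw [← ENNReal.le_rpow_inv_iff hb, ← one_div, ENNReal.mul_rpow_of_nonneg _ _ (by positivity),
    ← ENNReal.rpow_mul, mul_one_div]

theorem _root_.ENNReal.pow_pow_div (b : ℕ) (x : ℝ≥0∞) :
    (x ^ (b + 1)) ^ ((b : ℝ) / (b + 1)) = x ^ b := by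
  rw [← ENNReal.rpow_natCast, ← ENNReal.rpow_mul, ← ENNReal.rpow_natCast]
  congr 1
  push_cast
  field_simp

/-- After taking roots, this is Hölder's inequality on a two-point space. It is what makes moments
jointly convex. -/
theorem _root_.ENNReal.add_pow_le_of_pow_le (b : ℕ) {x₁ x₂ y₁ y₂ z₁ z₂ : ℝ≥0∞}
    (h₁ : x₁ ^ (b + 1) ≤ y₁ ^ b * z₁) (h₂ : x₂ ^ (b + 1) ≤ y₂ ^ b * z₂) :
    (x₁ + x₂) ^ (b + 1) ≤ (y₁ + y₂) ^ b * (z₁ + z₂) := by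
  rw [ENNReal.pow_succ_le_pow_mul_iff] at *
  have hb : (0 : ℝ) < (b : ℝ) + 1 := by positivity
  have key := ENNReal.lintegral_mul_norm_pow_le (μ := Measure.count) (α := Bool)
    (f := fun i => if i then y₁ else y₂) (g := fun i => if i then z₁ else z₂)
    (measurable_of_finite _).aemeasurable (measurable_of_finite _).aemeasurable
    (p := (b : ℝ) / (b + 1)) (q := 1 / ((b : ℝ) + 1)) (by positivity) (by positivity)
    (by field_simp)
  simp only [lintegral_count, tsum_bool] at key
  refine le_trans ?_ (le_trans key ?_)
  · simpa [add_comm] using add_le_add h₁ h₂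
  · simp [add_comm]

namespace MomentBound

variable {α β : Type*} [MeasurableSpace α] [MeasurableSpace β] {b : ℕ} {P Q P' Q' : Measure α}
  {A B : ℝ≥0∞}

theorem mono (h : MomentBound b P Q A) (hAB : A ≤ B) : MomentBound b P Q B :=
  fun f hf => (h f hf).trans (by gcongr)

theorem add (h : MomentBound b P Q A) (h' : MomentBound b P' Q' B) :
    MomentBound b (P + P') (Q + Q') (A + B) := by
  intro f hf
  simp only [lintegral_add_measure]
  exact ENNReal.add_pow_le_of_pow_le b (h f hf) (h' f hf)

theorem smul (h : MomentBound b P Q A) (c : ℝ≥0∞) : MomentBound b (c • P) (c • Q) (c * A) := by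
  intro f hf
  simp only [lintegral_smul_measure, smul_eq_mul]
  calc (c * ∫⁻ x, f x ^ b ∂P) ^ (b + 1) = c ^ (b + 1) * (∫⁻ x, f x ^ b ∂P) ^ (b + 1) := mul_pow _ _ _
    _ ≤ c ^ (b + 1) * ((∫⁻ x, f x ^ (b + 1) ∂Q) ^ b * A) := by gcongr; exact h f hf
    _ = _ := by ring

theorem zero : MomentBound b (0 : Measure α) 0 0 := fun f _ => by simp

theorem sum {ι : Type*} (s : Finset ι) {P Q : ι → Measure α} {A : ι → ℝ≥0∞}
    (h : ∀ i ∈ s, MomentBound b (P i) (Q i) (A i)) :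
    MomentBound b (∑ i ∈ s, P i) (∑ i ∈ s, Q i) (∑ i ∈ s, A i) := by
  classical
  induction s using Finset.induction_on with
  | empty => simpa using zero
  | insert i s hi ih =>
    simp only [Finset.sum_insert hi]
    exact (h i (Finset.mem_insert_self i s)).add
      (ih fun j hj => h j (Finset.mem_insert_of_mem hj))

theorem map (h : MomentBound b P Q A) {g : α → β} (hg : Measurable g) :
    MomentBound b (P.map g) (Q.map g) A := by
  intro f hf
  rw [lintegral_map (hf.pow_const _) hg, lintegral_map (hf.pow_const _) hg]
  exact h _ (hf.comp hg)

/-- Adaptive composition: the bound on the kernels is uniform in the starting point, so it factors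
out of the outer integral. -/
theorem bind (h : MomentBound b P Q A) {κ κ' : α → Measure β} (hκ : Measurable κ)
    (hκ' : Measurable κ') (hB : ∀ x, MomentBound b (κ x) (κ' x) B) :
    MomentBound b (P.bind κ) (Q.bind κ') (A * B) := by
  intro f hf
  rw [Measure.lintegral_bind hκ.aemeasurable (hf.pow_const _).aemeasurable,
    Measure.lintegral_bind hκ'.aemeasurable (hf.pow_const _).aemeasurable]
  have hm : Measurable fun x => ∫⁻ y, f y ^ (b + 1) ∂κ' x :=
    (Measure.measurable_lintegral (hf.pow_const _)).comp hκ'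
  -- The `(b+1)`-th root of the inner integral serves as test function for the outer bound: its
  -- power `b` dominates the inner integral under `κ`, up to a constant, and its power `b + 1`
  -- restores the inner integral under `κ'`.
  set F : α → ℝ≥0∞ := fun x => (∫⁻ y, f y ^ (b + 1) ∂κ' x) ^ (1 / ((b : ℝ) + 1)) with hF
  have hFm : Measurable F := hm.pow_const _
  have hb : (0 : ℝ) < (b : ℝ) + 1 := by positivity
  have hF1 : ∀ x, F x ^ (b + 1) = ∫⁻ y, f y ^ (b + 1) ∂κ' x := fun x => by
    rw [← ENNReal.rpow_natCast, ← ENNReal.rpow_mul]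
    push_cast
    rw [one_div_mul_cancel hb.ne', ENNReal.rpow_one]
  have hle : ∀ x, ∫⁻ y, f y ^ b ∂κ x ≤ F x ^ b * B ^ (1 / ((b : ℝ) + 1)) := fun x => by
    have := (ENNReal.pow_succ_le_pow_mul_iff b _ _ _).1 (hB x f hf)
    rwa [← hF1 x, ENNReal.pow_pow_div] at this
  calc (∫⁻ x, ∫⁻ y, f y ^ b ∂κ x ∂P) ^ (b + 1)
      ≤ (∫⁻ x, F x ^ b * B ^ (1 / ((b : ℝ) + 1)) ∂P) ^ (b + 1) := by
        gcongr with x; exact hle x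
    _ = (∫⁻ x, F x ^ b ∂P) ^ (b + 1) * B := by
        rw [lintegral_mul_const _ (hFm.pow_const _), mul_pow]
        congr 1
        rw [← ENNReal.rpow_natCast, ← ENNReal.rpow_mul]
        push_cast
        rw [one_div_mul_cancel hb.ne', ENNReal.rpow_one]
    _ ≤ (∫⁻ x, F x ^ (b + 1) ∂Q) ^ b * A * B := by gcongr; exact h F hFm
    _ = _ := by simp only [hF1, mul_assoc]

/-- Hölder with exponents `b/(b+1)` and `1/(b+1)`, applied to `q f^(b+1)` and `h`; in the
applications `h = p^(b+1) / q^b`. -/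
theorem withDensity {μ : Measure α} {p q h : α → ℝ≥0∞} (hp : Measurable p) (hq : Measurable q)
    (hh : Measurable h) (hpq : ∀ x, p x ^ (b + 1) ≤ q x ^ b * h x) :
    MomentBound b (μ.withDensity p) (μ.withDensity q) (∫⁻ x, h x ∂μ) := by
  intro f hf
  rw [lintegral_withDensity_eq_lintegral_mul _ hp (hf.pow_const _),
    lintegral_withDensity_eq_lintegral_mul _ hq (hf.pow_const _),
    ENNReal.pow_succ_le_pow_mul_iff]
  simp only [Pi.mul_apply]
  refine le_trans (lintegral_mono fun x => ?_) (ENNReal.lintegral_mul_norm_pow_le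
    (f := fun x => q x * f x ^ (b + 1)) (g := h) (hq.mul (hf.pow_const _)).aemeasurable
    hh.aemeasurable (by positivity) (by positivity) (by field_simp))
  rw [ENNReal.mul_rpow_of_nonneg _ _ (by positivity), ENNReal.pow_pow_div, mul_right_comm]
  gcongr
  exact (ENNReal.pow_succ_le_pow_mul_iff b _ _ _).1 (hpq x)

theorem self [IsProbabilityMeasure P] : MomentBound b P P 1 := by
  have := withDensity (μ := P) (b := b) (p := 1) (q := 1) (h := 1) measurable_one measurable_one
    measurable_one (by simp)
  simpa using this

/-- Conversion of a moment bound to approximate differential privacy. -/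
theorem measure_le (h : MomentBound b P Q A) (hb : b ≠ 0) {ρ ε δ : ℝ} (hδ : 0 < δ)
    (hA : A ≤ ENNReal.ofReal (Real.exp (b * ρ))) (hε : ρ + Real.log (1 / δ) / b ≤ ε)
    {S : Set α} (hS : MeasurableSet S) (hP : P S ≠ ∞) (hQ : Q S ≠ ∞) :
    P S ≤ ENNReal.ofReal (Real.exp ε) * Q S + ENNReal.ofReal δ := by
  have h1 := h.mono hA (S.indicator 1) (measurable_one.indicator hS)
  have hi : ∀ k : ℕ, k ≠ 0 → ∀ μ : Measure α, ∫⁻ x, (S.indicator 1 x : ℝ≥0∞) ^ k ∂μ = μ S := by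
    intro k hk μ
    rw [← lintegral_indicator_one hS]
    congr with x
    by_cases hx : x ∈ S <;> simp [hx, hk]
  rw [hi b hb, hi (b + 1) (by omega)] at h1
  lift P S to ℝ≥0 using hP with x
  lift Q S to ℝ≥0 using hQ with y
  have h2 : (x : ℝ) ^ (b + 1) ≤ y ^ b * Real.exp (b * ρ) := by
    have := ENNReal.toReal_mono (by finiteness) h1
    simpa [Real.exp_nonneg] using this
  have h3 : (x : ℝ) ≤ Real.exp ε * y + δ := by
    -- If `P S > e^ε Q S + δ`, then `P S` exceeds both `e^ε Q S` and `δ`. Since `e^(bρ) ≤ e^(bε) δ`,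
    -- the moment bound gives `(P S)^(b+1) ≤ (e^ε Q S)^b δ < (P S)^(b+1)`.
    by_contra! hlt
    have hx1 : Real.exp ε * y ≤ x := by linarith
    have hx2 : δ < x := 
      lt_of_le_of_lt (le_add_of_nonneg_left (by positivity)) hlt
    have hb' : (0 : ℝ) < b := by positivity
    have e1 : Real.exp (b * ρ) ≤ Real.exp ε ^ b * δ := by
      rw [← Real.exp_nat_mul]
      rw [← Real.exp_log hδ, ← Real.exp_add, Real.exp_le_exp]
      have : b * (ρ + Real.log (1 / δ) / b) ≤ b * ε := by gcongr
      rw [one_div, Real.log_inv] at this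
      rw [mul_add, mul_div_cancel₀ _ hb'.ne'] at this
      linarith
    have hx0 : (0 : ℝ) < x := hδ.trans hx2
    have : (x : ℝ) ^ (b + 1) < x ^ (b + 1) := calc
      (x : ℝ) ^ (b + 1) ≤ y ^ b * Real.exp (b * ρ) := h2
      _ ≤ y ^ b * (Real.exp ε ^ b * δ) := by gcongr
      _ = (Real.exp ε * y) ^ b * δ := by ring
      _ ≤ x ^ b * δ := by gcongr
      _ < x ^ b * x := by gcongr
      _ = x ^ (b + 1) := by ring
    exact lt_irrefl _ this
  rw [← ENNReal.ofReal_coe_nnreal, ← ENNReal.ofReal_coe_nnreal (p := y),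
    ← ENNReal.ofReal_mul (Real.exp_nonneg _), ← ENNReal.ofReal_add (by positivity) hδ.le]
  exact ENNReal.ofReal_le_ofReal h3

end MomentBound

/-! ### Gaussian shifts -/

section Gaussian

variable {ι : Type*} [Fintype ι]

/-- The standard Gaussian measure on `ι → ℝ`. -/
noncomputable abbrev stdGauss (ι : Type*) [Fintype ι] : Measure (ι → ℝ) :=
  Measure.pi fun _ => gaussianReal 0 1

/-- The density of the standard Gaussian measure translated by `v` with respect to the standard
Gaussian measure. -/
noncomputable def gaussDensity (v x : ι → ℝ) : ℝ :=
  Real.exp (∑ i, v i * x i - (∑ i, v i ^ 2) / 2)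

theorem gaussDensity_pos (v x : ι → ℝ) : 0 < gaussDensity v x := Real.exp_pos _

theorem continuous_gaussDensity (v : ι → ℝ) : Continuous (gaussDensity v) := by
  unfold gaussDensity
  fun_prop

theorem integrable_exp_sum_mul (w : ι → ℝ) :
    Integrable (fun x => Real.exp (∑ i, w i * x i)) (stdGauss ι) := by
  simp only [Real.exp_sum]
  exact Integrable.fintype_prod_dep (f := fun i (y : ℝ) => Real.exp (w i * y))
    fun i => integrable_exp_mul_gaussianReal (w i)

theorem integral_exp_sum_mul (w : ι → ℝ) :
    ∫ x, Real.exp (∑ i, w i * x i) ∂stdGauss ι = Real.exp ((∑ i, w i ^ 2) / 2) := by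
  simp only [Real.exp_sum]
  rw [integral_fintype_prod_eq_prod (f := fun i (y : ℝ) => Real.exp (w i * y)), Finset.sum_div,
    Real.exp_sum]
  refine Finset.prod_congr rfl fun i _ => ?_
  have := congrFun (mgf_fun_id_gaussianReal (μ := 0) (v := 1)) (w i)
  simpa [mgf] using this

/-- The exponent stays affine in `x`, so every moment needed below is a value of the Gaussian moment
generating function. -/
theorem gaussDensity_pow_div_pow (k : ℕ) (u w x : ι → ℝ) :
    gaussDensity u x ^ (k + 1) / gaussDensity w x ^ k =
      Real.exp (∑ i, ((k + 1) * u i - k * w i) * x i) *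
        Real.exp (-((k + 1) * ∑ i, u i ^ 2 - k * ∑ i, w i ^ 2) / 2) := by
  simp only [gaussDensity, ← Real.exp_nat_mul, ← Real.exp_sub, ← Real.exp_add]
  congr 1
  simp only [sub_mul, Finset.sum_sub_distrib, mul_assoc, ← Finset.mul_sum]
  push_cast
  ring

theorem integrable_gaussDensity_pow_div_pow (k : ℕ) (u w : ι → ℝ) :
    Integrable (fun x => gaussDensity u x ^ (k + 1) / gaussDensity w x ^ k) (stdGauss ι) := by
  simp only [gaussDensity_pow_div_pow]
  exact (integrable_exp_sum_mul _).mul_const _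

theorem integral_gaussDensity_pow_div_pow (k : ℕ) (u w : ι → ℝ) :
    ∫ x, gaussDensity u x ^ (k + 1) / gaussDensity w x ^ k ∂stdGauss ι =
      Real.exp ((k + 1) * k * (∑ i, (u i - w i) ^ 2) / 2) := by
  simp only [gaussDensity_pow_div_pow]
  rw [integral_mul_const, integral_exp_sum_mul, ← Real.exp_add]
  congr 1
  rw [← add_div]
  congr 1
  simp only [Finset.mul_sum, ← Finset.sum_sub_distrib, ← Finset.sum_neg_distrib,
    ← Finset.sum_add_distrib]
  exact Finset.sum_congr rfl fun i _ => by ring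

theorem integrable_gaussDensity (v : ι → ℝ) : Integrable (gaussDensity v) (stdGauss ι) := by
  simpa using integrable_gaussDensity_pow_div_pow 0 v v

theorem integral_gaussDensity (v : ι → ℝ) : ∫ x, gaussDensity v x ∂stdGauss ι = 1 := by
  simpa using integral_gaussDensity_pow_div_pow 0 v v

theorem gaussianReal_eq_withDensity (v : ℝ) :
    gaussianReal v 1 = (gaussianReal 0 1).withDensity
      fun x => ENNReal.ofReal (Real.exp (v * x - v ^ 2 / 2)) := by
  rw [gaussianReal_of_var_ne_zero _ one_ne_zero, gaussianReal_of_var_ne_zero _ one_ne_zero,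
    ← withDensity_mul _ (measurable_gaussianPDF _ _) (by fun_prop)]
  congr with x
  simp only [gaussianPDF, gaussianPDFReal, Pi.mul_apply]
  rw [← ENNReal.ofReal_mul (by positivity), mul_assoc _ (Real.exp _) (Real.exp _), ← Real.exp_add]
  congr 3
  simp
  ring

theorem map_add_stdGauss (v : ι → ℝ) :
    (stdGauss ι).map (v + ·) =
      (stdGauss ι).withDensity fun x => ENNReal.ofReal (gaussDensity v x) := by
  have h1 : (stdGauss ι).map (v + ·) = Measure.pi fun i => gaussianReal (v i) 1 := by
    have := Measure.pi_map_pi (μ := fun _ : ι => gaussianReal 0 1) (f := fun i y => v i + y)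
      (hμ := fun i => by rw [gaussianReal_map_const_add]; infer_instance)
      (fun i => by fun_prop)
    simp only [gaussianReal_map_const_add, zero_add] at this
    exact this
  rw [h1]
  refine Measure.pi_eq fun s hs => ?_
  set g : ι → ℝ → ℝ≥0∞ := fun i =>
    (s i).indicator fun y => ENNReal.ofReal (Real.exp (v i * y - v i ^ 2 / 2)) with hg
  have hgm : ∀ i, Measurable (g i) := fun i => Measurable.indicator (by fun_prop) (hs i)
  rw [withDensity_apply _ (MeasurableSet.univ_pi hs), ← lintegral_indicator (.univ_pi hs)]
  have h2 : ∀ x, (Set.univ.pi s).indicator (fun x => ENNReal.ofReal (gaussDensity v x)) x =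
      ∏ i, g i (x i) := by
    intro x
    by_cases hx : x ∈ Set.univ.pi s
    · rw [Set.indicator_of_mem hx]
      simp only [hg]
      rw [Finset.prod_congr rfl fun i _ => Set.indicator_of_mem (hx i trivial) _,
        ← ENNReal.ofReal_prod_of_nonneg fun _ _ => (Real.exp_pos _).le, ← Real.exp_sum,
        gaussDensity, Finset.sum_sub_distrib, Finset.sum_div]
    · rw [Set.indicator_of_notMem hx]
      simp only [Set.mem_univ_pi, not_forall] at hx
      obtain ⟨i, hi⟩ := hx
      exact (Finset.prod_eq_zero (Finset.mem_univ i) (Set.indicator_of_notMem hi _)).symm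
  simp only [h2]
  refine (lintegral_prod_eq_prod_lintegral_of_indepFun Finset.univ
    (fun i (x : ι → ℝ) => g i (x i)) (iIndepFun_pi fun i => (hgm i).aemeasurable)
    fun i => (hgm i).comp (measurable_pi_apply i)).trans ?_
  refine Finset.prod_congr rfl fun i _ => ?_
  rw [gaussianReal_eq_withDensity (v i), withDensity_apply _ (hs i), ← lintegral_indicator (hs i)]
  exact (measurePreserving_eval (fun _ : ι => gaussianReal 0 1) i).lintegral_comp (hgm i)

theorem MomentBound.gaussian (b : ℕ) {u v : ι → ℝ} {r : ℝ} (h : ∑ i, (u i - v i) ^ 2 ≤ r) :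
    MomentBound b ((stdGauss ι).map (u + ·)) ((stdGauss ι).map (v + ·))
      (ENNReal.ofReal (Real.exp (b * ((b + 1) * r / 2)))) := by
  rw [map_add_stdGauss, map_add_stdGauss]
  have hm : ∀ w : ι → ℝ, Measurable fun x => ENNReal.ofReal (gaussDensity w x) :=
    fun w => (continuous_gaussDensity w).measurable.ennreal_ofReal
  refine (MomentBound.withDensity
    (h := fun x => ENNReal.ofReal (gaussDensity u x ^ (b + 1) / gaussDensity v x ^ b))
    (hm u) (hm v) ?_ ?_).mono ?_
  · exact (((continuous_gaussDensity u).measurable.pow_const _).div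
      ((continuous_gaussDensity v).measurable.pow_const _)).ennreal_ofReal
  · intro x
    have := gaussDensity_pos v x
    rw [← ENNReal.ofReal_pow (gaussDensity_pos u x).le, ← ENNReal.ofReal_pow this.le,
      ← ENNReal.ofReal_mul (by positivity), mul_div_cancel₀ _ (by positivity)]
  · rw [← ofReal_integral_eq_lintegral_ofReal (integrable_gaussDensity_pow_div_pow b u v)
      (.of_forall fun x => div_nonneg (pow_nonneg (gaussDensity_pos u x).le _)
        (pow_nonneg (gaussDensity_pos v x).le _)), integral_gaussDensity_pow_div_pow]
    refine ENNReal.ofReal_le_ofReal (Real.exp_le_exp.2 ?_)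
    calc _ = (b + 1) * b / 2 * ∑ i, (u i - v i) ^ 2 := by ring
      _ ≤ (b + 1) * b / 2 * r := by gcongr
      _ = _ := by ring

end Gaussian

/-! ### Amplification by subsampling -/

section Subsampling

theorem inv_pow_convex_comb_le {p s t : ℝ} (hp : 0 ≤ p) (hp1 : p ≤ 1) (hs : 0 < s) (ht : 0 < t)
    (k : ℕ) : ((p * s + (1 - p) * t) ^ k)⁻¹ ≤ p * (s ^ k)⁻¹ + (1 - p) * (t ^ k)⁻¹ := by
  have := (convexOn_zpow (𝕜 := ℝ) (-(k : ℤ))).2 (Set.mem_Ioi.2 hs) (Set.mem_Ioi.2 ht) hp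
    (sub_nonneg.2 hp1) (by ring)
  simpa using this

/-- The numerator is `(Q + p (x - y))^(b+1)` with `Q` the mixture in the denominator. The terms of
degree 0 and 1 of its binomial expansion are kept exactly; in the others the negative power of `Q`
is split by convexity into powers of `y` and `z`. -/
theorem pow_div_pow_mixture_le {p x y z : ℝ} (hp : 0 ≤ p) (hp1 : p ≤ 1)
    (hy : 0 < y) (hz : 0 < z) (b : ℕ) :
    (p * x + (1 - p) * z) ^ (b + 1) / (p * y + (1 - p) * z) ^ b ≤
      (p * y + (1 - p) * z) + (b + 1) * (p * (x - y)) +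
        ∑ k ∈ Finset.range b, ((b + 1).choose (k + 2)) * p ^ (k + 2) *
          (p * (|x - y| ^ (k + 2) / y ^ (k + 1)) +
            (1 - p) * (|x - y| ^ (k + 2) / z ^ (k + 1))) := by
  set Q := p * y + (1 - p) * z with hQ
  have hQ0 : 0 < Q := by
    rcases hp.eq_or_lt with rfl | h
    · simpa [hQ] using hz
    · have : 0 ≤ (1 - p) * z := mul_nonneg (sub_nonneg.2 hp1) hz.le
      positivity
  have hP : p * x + (1 - p) * z = p * (x - y) + Q := by rw [hQ]; ring
  rw [hP, add_pow, Finset.sum_range_succ', Finset.sum_range_succ', add_div, add_div,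
    Finset.sum_div, add_assoc, add_comm]
  refine add_le_add (le_of_eq ?_) (Finset.sum_le_sum fun k hk => ?_)
  · simp only [zero_add, pow_zero, pow_one, Nat.choose_one_right, Nat.choose_zero_right,
      Nat.add_sub_cancel, Nat.sub_zero]
    field_simp
    push_cast
    ring
  · have hk' : b = (b + 1 - (k + 1 + 1)) + (k + 1) := by
      have := Finset.mem_range.1 hk
      omega
    have hdiv : Q ^ (b + 1 - (k + 1 + 1)) / Q ^ b = (Q ^ (k + 1))⁻¹ := by
      have : Q ^ b = Q ^ (b + 1 - (k + 1 + 1)) * Q ^ (k + 1) := by rw [← pow_add, ← hk']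
      rw [this, div_mul_cancel_left₀ (pow_ne_zero _ hQ0.ne')]
    calc (p * (x - y)) ^ (k + 1 + 1) * Q ^ (b + 1 - (k + 1 + 1)) *
            ((b + 1).choose (k + 1 + 1)) / Q ^ b
        = ((b + 1).choose (k + 2)) * p ^ (k + 2) * ((x - y) ^ (k + 2) * (Q ^ (k + 1))⁻¹) := by
          rw [← hdiv, mul_pow]
          ring
      _ ≤ ((b + 1).choose (k + 2)) * p ^ (k + 2) * (|x - y| ^ (k + 2) *
            (p * (y ^ (k + 1))⁻¹ + (1 - p) * (z ^ (k + 1))⁻¹)) := by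
          refine mul_le_mul_of_nonneg_left (mul_le_mul ?_
            (inv_pow_convex_comb_le hp hp1 hy hz _) (by positivity) (by positivity))
            (by positivity)
          rw [← abs_pow]
          exact le_abs_self _
      _ = _ := by
          simp only [div_eq_mul_inv]
          ring

theorem abs_sub_pow_le_add {x y : ℝ} (hx : 0 ≤ x) (hy : 0 ≤ y) (k : ℕ) :
    |x - y| ^ k ≤ x ^ k + y ^ k := by
  have : |x - y| ≤ max x y := by
    rw [abs_le]
    constructor <;> linarith [le_max_left x y, le_max_right x y]
  rcases le_total x y with h | h
  · rw [max_eq_right h] at this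
    exact (pow_le_pow_left₀ (abs_nonneg _) this k).trans (le_add_of_nonneg_left (by positivity))
  · rw [max_eq_left h] at this
    exact (pow_le_pow_left₀ (abs_nonneg _) this k).trans (le_add_of_nonneg_right (by positivity))

variable {ι : Type*} [Fintype ι]

/-- The bound on `∫ |d_u - d_v|^j / d_w^(j-1)` for three Gaussian densities whose means are within
squared distance `r` of each other. -/
noncomputable def ternaryBound (r : ℝ) (j : ℕ) : ℝ :=
  if j = 2 then min (4 * (Real.exp r - 1)) (2 * Real.exp r)
  else 2 * Real.exp (j * (j - 1) * r / 2)

theorem abs_sub_pow_div_le (u v w x : ι → ℝ) (k : ℕ) :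
    |gaussDensity u x - gaussDensity v x| ^ (k + 1) / gaussDensity w x ^ k ≤
      gaussDensity u x ^ (k + 1) / gaussDensity w x ^ k +
        gaussDensity v x ^ (k + 1) / gaussDensity w x ^ k := by
  have := gaussDensity_pos w x
  rw [← add_div]
  gcongr
  exact abs_sub_pow_le_add (gaussDensity_pos u x).le (gaussDensity_pos v x).le _

theorem continuous_ternary (u v w : ι → ℝ) (k : ℕ) : Continuous fun x =>
    |gaussDensity u x - gaussDensity v x| ^ (k + 1) / gaussDensity w x ^ k :=
  ((((continuous_gaussDensity u).sub (continuous_gaussDensity v)).abs).pow _).div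
    ((continuous_gaussDensity w).pow _) fun x => pow_ne_zero _ (gaussDensity_pos w x).ne'

theorem integrable_ternary (u v w : ι → ℝ) (k : ℕ) : Integrable (fun x =>
    |gaussDensity u x - gaussDensity v x| ^ (k + 1) / gaussDensity w x ^ k) (stdGauss ι) := by
  refine ((integrable_gaussDensity_pow_div_pow k u w).add
    (integrable_gaussDensity_pow_div_pow k v w)).mono'
    (continuous_ternary u v w k).aestronglyMeasurable (.of_forall fun x => ?_)
  have := gaussDensity_pos w x
  rw [Real.norm_of_nonneg (by positivity)]
  exact abs_sub_pow_div_le u v w x k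

theorem integral_ternary_le {u v w : ι → ℝ} {r : ℝ} (hu : ∑ i, (u i - w i) ^ 2 ≤ r)
    (hv : ∑ i, (v i - w i) ^ 2 ≤ r) (k : ℕ) :
    ∫ x, |gaussDensity u x - gaussDensity v x| ^ (k + 2) / gaussDensity w x ^ (k + 1) ∂stdGauss ι
      ≤ ternaryBound r (k + 2) := by
  have hle : ∀ (k : ℕ) (v : ι → ℝ), ∑ i, (v i - w i) ^ 2 ≤ r →
      ∫ x, gaussDensity v x ^ (k + 1) / gaussDensity w x ^ k ∂stdGauss ι ≤
        Real.exp ((k + 1) * k * r / 2) := fun k v hv => by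
    rw [integral_gaussDensity_pow_div_pow]
    gcongr
  have hgen : ∀ k : ℕ,
      ∫ x, |gaussDensity u x - gaussDensity v x| ^ (k + 1) / gaussDensity w x ^ k ∂stdGauss ι
      ≤ 2 * Real.exp ((k + 1) * k * r / 2) := fun k => by
    calc _ ≤ ∫ x, (gaussDensity u x ^ (k + 1) / gaussDensity w x ^ k +
          gaussDensity v x ^ (k + 1) / gaussDensity w x ^ k) ∂stdGauss ι :=
          integral_mono (integrable_ternary u v w k)
            ((integrable_gaussDensity_pow_div_pow k u w).add
              (integrable_gaussDensity_pow_div_pow k v w)) (abs_sub_pow_div_le u v w · k)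
      _ ≤ _ := by
          rw [integral_add (integrable_gaussDensity_pow_div_pow k u w)
            (integrable_gaussDensity_pow_div_pow k v w), two_mul]
          exact add_le_add (hle k u hu) (hle k v hv)
  unfold ternaryBound
  split_ifs with hk
  · obtain rfl : k = 0 := by omega
    refine le_min ?_ ?_
    -- `D v` is `(d_v - d_w)² / d_w` expanded, the chi-square integrand, and `(d_u - d_v)² ≤ 2 (d_u
    -- - d_w)² + 2 (d_v - d_w)²` yields `4 (e^r - 1)`. This vanishes as `r → 0`, unlike the crude `2
    -- e^r`.
    · set D : (ι → ℝ) → (ι → ℝ) → ℝ := fun v x =>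
        gaussDensity v x ^ (1 + 1) / gaussDensity w x ^ 1 - 2 * gaussDensity v x +
          gaussDensity w x with hD
      have hDi : ∀ v, Integrable (D v) (stdGauss ι) := fun v =>
        ((integrable_gaussDensity_pow_div_pow 1 v w).sub
          ((integrable_gaussDensity v).const_mul 2)).add (integrable_gaussDensity w)
      have hDI : ∀ v, ∑ i, (v i - w i) ^ 2 ≤ r → ∫ x, D v x ∂stdGauss ι ≤ Real.exp r - 1 := by
        intro v hv
        have h1 : Integrable (fun x => gaussDensity v x ^ (1 + 1) / gaussDensity w x ^ 1 -
            2 * gaussDensity v x) (stdGauss ι) :=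
          (integrable_gaussDensity_pow_div_pow 1 v w).sub ((integrable_gaussDensity v).const_mul 2)
        simp only [hD]
        rw [integral_add h1 (integrable_gaussDensity w),
          integral_sub (integrable_gaussDensity_pow_div_pow 1 v w)
          ((integrable_gaussDensity v).const_mul 2), integral_const_mul, integral_gaussDensity,
          integral_gaussDensity]
        have := hle 1 v hv
        norm_num at this ⊢
        linarith
      calc _ ≤ ∫ x, (2 * D u x + 2 * D v x) ∂stdGauss ι := by
            refine integral_mono (integrable_ternary u v w 1)
              (((hDi u).const_mul 2).add ((hDi v).const_mul 2)) fun x => ?_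
            simp only [hD]
            have hw := gaussDensity_pos w x
            have h2 : ∀ y, y ^ (1 + 1) / gaussDensity w x ^ 1 - 2 * y + gaussDensity w x =
                (y - gaussDensity w x) ^ 2 / gaussDensity w x := fun y => by
              field_simp
              ring
            rw [h2, h2, sq_abs, zero_add, pow_one, mul_div_assoc', mul_div_assoc', ← add_div]
            gcongr
            nlinarith [sq_nonneg (gaussDensity u x + gaussDensity v x - 2 * gaussDensity w x)]
        _ ≤ _ := by
            rw [integral_add ((hDi u).const_mul 2) ((hDi v).const_mul 2), integral_const_mul,
              integral_const_mul]
            linarith [hDI u hu, hDI v hv]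
    · have := hgen 1
      norm_num at this ⊢
      exact this
  · refine (hgen (k + 1)).trans (le_of_eq ?_)
    push_cast
    ring_nf

theorem subsampledMoment_eq (r p : ℝ) {b : ℕ} (hb : b ≠ 0) :
    subsampledMoment r p (b + 1) = 1 + ∑ k ∈ Finset.range b,
      ((b + 1).choose (k + 2)) * p ^ (k + 2) * ternaryBound r (k + 2) := by
  obtain ⟨c, rfl⟩ := Nat.exists_eq_succ_of_ne_zero hb
  rw [Finset.sum_range_succ', subsampledMoment, add_assoc, add_comm (p ^ 2 * _ * _)]
  congr 2
  · rw [← Finset.Ico_add_one_right_eq_Icc, Finset.sum_Ico_eq_sum_range]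
    refine Finset.sum_congr (by congr 1) fun k _ => ?_
    rw [ternaryBound, if_neg (by omega), show k + 1 + 2 = 3 + k by ring]
    ring
  · simp only [ternaryBound, zero_add, if_true]
    ring

theorem ternaryBound_nonneg {r : ℝ} (hr : 0 ≤ r) (j : ℕ) : 0 ≤ ternaryBound r j := by
  have := Real.one_le_exp hr
  unfold ternaryBound
  split_ifs
  · exact le_min (by linarith) (by linarith)
  · positivity

theorem one_le_subsampledMoment {r p : ℝ} (hr : 0 ≤ r) (hp : 0 ≤ p) {b : ℕ} (hb : b ≠ 0) :
    1 ≤ subsampledMoment r p (b + 1) := by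
  rw [subsampledMoment_eq r p hb]
  refine le_add_of_nonneg_right (Finset.sum_nonneg fun k _ => ?_)
  have := ternaryBound_nonneg hr (k + 2)
  positivity

/-- `p` is the share of batches of a given size that contain the changed index; `w` is the mean for
a batch without it, common to both datasets. -/
theorem MomentBound.subsampled {b : ℕ} (hb : b ≠ 0) {u v w : ι → ℝ} {r p : ℝ} (hp : 0 ≤ p)
    (hp1 : p ≤ 1) (huv : ∑ i, (u i - v i) ^ 2 ≤ r) (huw : ∑ i, (u i - w i) ^ 2 ≤ r)
    (hvw : ∑ i, (v i - w i) ^ 2 ≤ r) :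
    MomentBound b
      (ENNReal.ofReal p • (stdGauss ι).map (u + ·) +
        ENNReal.ofReal (1 - p) • (stdGauss ι).map (w + ·))
      (ENNReal.ofReal p • (stdGauss ι).map (v + ·) +
        ENNReal.ofReal (1 - p) • (stdGauss ι).map (w + ·))
      (ENNReal.ofReal (subsampledMoment r p (b + 1))) := by
  have hq : 0 ≤ 1 - p := sub_nonneg.2 hp1
  have hm : ∀ w : ι → ℝ, Measurable (gaussDensity w) :=
    fun w => (continuous_gaussDensity w).measurable
  have hmix : ∀ u : ι → ℝ, ENNReal.ofReal p • (stdGauss ι).map (u + ·) +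
      ENNReal.ofReal (1 - p) • (stdGauss ι).map (w + ·) = (stdGauss ι).withDensity
        fun x => ENNReal.ofReal (p * gaussDensity u x + (1 - p) * gaussDensity w x) := by
    intro u
    rw [map_add_stdGauss, map_add_stdGauss, ← withDensity_smul _ (hm u).ennreal_ofReal,
      ← withDensity_smul _ (hm w).ennreal_ofReal,
      ← withDensity_add_left ((hm u).ennreal_ofReal.const_smul _)]
    congr with x
    simp only [Pi.add_apply, Pi.smul_apply, smul_eq_mul]
    rw [← ENNReal.ofReal_mul hp, ← ENNReal.ofReal_mul hq, ← ENNReal.ofReal_add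
      (mul_nonneg hp (gaussDensity_pos u x).le) (mul_nonneg hq (gaussDensity_pos w x).le)]
  have hpos : ∀ (u : ι → ℝ) x, 0 < p * gaussDensity u x + (1 - p) * gaussDensity w x := by
    intro u x
    rcases hp.eq_or_lt with rfl | h
    · simpa using gaussDensity_pos w x
    · have := mul_nonneg hq (gaussDensity_pos w x).le
      have := gaussDensity_pos u x
      positivity
  rw [hmix, hmix]
  set P := fun x => p * gaussDensity u x + (1 - p) * gaussDensity w x
  set Q := fun x => p * gaussDensity v x + (1 - p) * gaussDensity w x
  have hPm : Measurable P := ((hm u).const_mul p).add ((hm w).const_mul _)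
  have hQm : Measurable Q := ((hm v).const_mul p).add ((hm w).const_mul _)
  refine (MomentBound.withDensity (h := fun x => ENNReal.ofReal (P x ^ (b + 1) / Q x ^ b))
    hPm.ennreal_ofReal hQm.ennreal_ofReal
    ((hPm.pow_const _).div (hQm.pow_const _)).ennreal_ofReal fun x => ?_).mono ?_
  · have := hpos v x
    rw [← ENNReal.ofReal_pow (hpos u x).le, ← ENNReal.ofReal_pow this.le,
      ← ENNReal.ofReal_mul (pow_nonneg this.le _), mul_div_cancel₀ _ (pow_pos this _).ne']
  have hI1 : Integrable (fun x => p * gaussDensity v x + (1 - p) * gaussDensity w x)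
      (stdGauss ι) :=
    ((integrable_gaussDensity v).const_mul p).add ((integrable_gaussDensity w).const_mul _)
  have hI2 : Integrable (fun x => (b + 1 : ℝ) * (p * (gaussDensity u x - gaussDensity v x)))
      (stdGauss ι) :=
    (((integrable_gaussDensity u).sub (integrable_gaussDensity v)).const_mul p).const_mul _
  have hI12 : Integrable (fun x => p * gaussDensity v x + (1 - p) * gaussDensity w x +
      (b + 1 : ℝ) * (p * (gaussDensity u x - gaussDensity v x))) (stdGauss ι) := hI1.add hI2
  set t : ℕ → (ι → ℝ) → (ι → ℝ) → ℝ := fun k w x =>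
    |gaussDensity u x - gaussDensity v x| ^ (k + 2) / gaussDensity w x ^ (k + 1) with ht
  have hti : ∀ k w, Integrable (t k w) (stdGauss ι) := fun k w => integrable_ternary u v w (k + 1)
  have hI3 : ∀ k, Integrable (fun x => ((b + 1).choose (k + 2)) * p ^ (k + 2) *
      (p * t k v x + (1 - p) * t k w x)) (stdGauss ι) := fun k =>
    (((hti k v).const_mul p).add ((hti k w).const_mul _)).const_mul _
  have hr : 0 ≤ r := (Finset.sum_nonneg fun i _ => sq_nonneg _).trans huv
  calc ∫⁻ x, ENNReal.ofReal (P x ^ (b + 1) / Q x ^ b) ∂stdGauss ι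
      ≤ ∫⁻ x, ENNReal.ofReal (p * gaussDensity v x + (1 - p) * gaussDensity w x +
          (b + 1) * (p * (gaussDensity u x - gaussDensity v x)) +
          ∑ k ∈ Finset.range b, ((b + 1).choose (k + 2)) * p ^ (k + 2) *
            (p * t k v x + (1 - p) * t k w x)) ∂stdGauss ι :=
        lintegral_mono fun x => ENNReal.ofReal_le_ofReal (pow_div_pow_mixture_le hp hp1
          (gaussDensity_pos v x) (gaussDensity_pos w x) b)
    _ = ENNReal.ofReal (∫ x, (p * gaussDensity v x + (1 - p) * gaussDensity w x +
          (b + 1) * (p * (gaussDensity u x - gaussDensity v x)) +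
          ∑ k ∈ Finset.range b, ((b + 1).choose (k + 2)) * p ^ (k + 2) *
            (p * t k v x + (1 - p) * t k w x)) ∂stdGauss ι) := by
        refine (ofReal_integral_eq_lintegral_ofReal
          (hI12.add (integrable_finsetSum _ fun k _ => hI3 k))
          (.of_forall fun x => ?_)).symm
        exact (div_nonneg (pow_nonneg (hpos u x).le _) (pow_nonneg (hpos v x).le _)).trans
          (pow_div_pow_mixture_le hp hp1 (gaussDensity_pos v x)
            (gaussDensity_pos w x) b)
    _ ≤ _ := by
        refine ENNReal.ofReal_le_ofReal ?_
        rw [integral_add hI12 (integrable_finsetSum _ fun k _ => hI3 k),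
          integral_add hI1 hI2, integral_finsetSum _ fun k _ => hI3 k, subsampledMoment_eq r p hb]
        refine add_le_add (le_of_eq ?_) (Finset.sum_le_sum fun k _ => ?_)
        -- All densities have integral 1, so the constant term contributes 1 and the linear term
        -- nothing.
        · rw [integral_add ((integrable_gaussDensity v).const_mul p)
            ((integrable_gaussDensity w).const_mul _), integral_const_mul, integral_const_mul,
            integral_const_mul, integral_const_mul, integral_sub (integrable_gaussDensity u)
            (integrable_gaussDensity v)]
          simp only [integral_gaussDensity]
          ring
        · rw [integral_const_mul, integral_add ((hti k v).const_mul p) ((hti k w).const_mul _),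
            integral_const_mul, integral_const_mul]
          gcongr
          -- Here the reference Gaussian is `v` itself, so its second distance is zero.
          have h1 : ∫ x, t k v x ∂stdGauss ι ≤ ternaryBound r (k + 2) :=
            integral_ternary_le huv (by simpa using hr) k
          have h2 : ∫ x, t k w x ∂stdGauss ι ≤ ternaryBound r (k + 2) :=
            integral_ternary_le huw hvw k
          calc _ ≤ p * ternaryBound r (k + 2) + (1 - p) * ternaryBound r (k + 2) := by gcongr
            _ = _ := by ring

end Subsampling

/-! ### Random batches -/

section Batches

variable {n : ℕ}

/-- Double counting: `(V, j)` corresponds to `(W, j)` with `W = insert j (V.erase i)` and `j ∈ W`,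
so each `W` avoiding `i` is hit `W.card` times. -/
theorem sum_swap_mem_notMem {M : Type*} [AddCommMonoid M] (i : Fin n)
    (g : Finset (Fin n) → M) :
    ∑ V with i ∈ V, ∑ j ∈ Vᶜ, g (insert j (V.erase i)) = ∑ V with i ∉ V, ∑ _j ∈ V, g V := by
  rw [Finset.sum_sigma', Finset.sum_sigma']
  refine Finset.sum_bij' (fun x _ => ⟨insert x.2 (x.1.erase i), x.2⟩)
    (fun x _ => ⟨insert i (x.1.erase x.2), x.2⟩) ?_ ?_ ?_ ?_ ?_
  · rintro ⟨V, j⟩ h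
    simp only [Finset.mem_sigma, Finset.mem_filter, Finset.mem_univ, true_and,
      Finset.mem_compl] at h ⊢
    have : i ≠ j := fun e => h.2 (e ▸ h.1)
    simp [this]
  · rintro ⟨V, j⟩ h
    simp only [Finset.mem_sigma, Finset.mem_filter, Finset.mem_univ, true_and,
      Finset.mem_compl] at h ⊢
    have : j ≠ i := fun e => h.1 (e ▸ h.2)
    simp [this]
  · rintro ⟨V, j⟩ h
    simp only [Finset.mem_sigma, Finset.mem_filter, Finset.mem_univ, true_and,
      Finset.mem_compl] at h
    have : j ∉ V.erase i := fun e => h.2 (Finset.mem_of_mem_erase e)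
    simp [Finset.erase_insert this, Finset.insert_erase h.1]
  · rintro ⟨V, j⟩ h
    simp only [Finset.mem_sigma, Finset.mem_filter, Finset.mem_univ, true_and] at h
    have : i ∉ V.erase j := fun e => h.1 (Finset.mem_of_mem_erase e)
    simp [Finset.erase_insert this, Finset.insert_erase h.2]
  · intros
    rfl

theorem card_insert_erase {V : Finset (Fin n)} {i j : Fin n} (hi : i ∈ V) (hj : j ∉ V) :
    (insert j (V.erase i)).card = V.card := by
  rw [Finset.card_insert_of_notMem fun e => hj (Finset.mem_of_mem_erase e),
    Finset.card_erase_add_one hi]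

/-- A batch that contains `i` is coupled with the batch in which `i` is replaced by a random
index outside of it. -/
theorem sum_batches_eq {M : Type*} [AddCommMonoid M] [Module ℝ≥0∞ M] (i : Fin n)
    (w : ℕ → ℝ) (hw : ∀ k, 0 ≤ w k) (g : Finset (Fin n) → M) :
    ∑ V ∈ batches n, ENNReal.ofReal (w V.card) • g V =
      ∑ V with i ∈ V, ∑ j ∈ Vᶜ,
        ENNReal.ofReal (w V.card * n / (V.card * (n - V.card))) •
          (ENNReal.ofReal (V.card / n) • g V +
            ENNReal.ofReal (1 - V.card / n) • g (insert j (V.erase i))) +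
        ENNReal.ofReal (w n) • g Finset.univ := by
  have hn : (0 : ℝ) < n := by exact_mod_cast i.pos
  have hcard : ∀ V : Finset (Fin n), i ∈ V → (0 : ℝ) < V.card := fun V h => by
    exact_mod_cast Finset.card_pos.2 ⟨i, h⟩
  have hlt : ∀ (V : Finset (Fin n)) (j : Fin n), j ∉ V → (0 : ℝ) < n - V.card := fun V j h => by
    rw [sub_pos]
    have : V.card < (Finset.univ : Finset (Fin n)).card :=
      Finset.card_lt_card (Finset.ssubset_univ_iff.2 fun e => h (e ▸ Finset.mem_univ j))
    rw [Finset.card_fin] at this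
    exact_mod_cast this
  -- With `k = V.card`, the weight of the pair splits into `w k / (n - k)` for `V`, which occurs
  -- with `n - k` choices of `j`, and `w k / k` for the swapped batch, which arises from `k` pairs.
  -- Both totals are `w k`.
  have h1 : ∀ V ∈ Finset.univ.filter (fun V : Finset (Fin n) => i ∈ V), ∀ j ∈ Vᶜ,
      ENNReal.ofReal (w V.card * n / (V.card * (n - V.card))) •
          (ENNReal.ofReal (V.card / n) • g V +
            ENNReal.ofReal (1 - V.card / n) • g (insert j (V.erase i))) =
      ENNReal.ofReal (w V.card / (n - V.card)) • g V +
        ENNReal.ofReal (w (insert j (V.erase i)).card / (insert j (V.erase i)).card) •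
          g (insert j (V.erase i)) := by
    intro V hV j hj
    rw [Finset.mem_filter] at hV
    rw [Finset.mem_compl] at hj
    have h2 := hcard V hV.2
    have h3 := hlt V j hj
    have h4 := hw V.card
    rw [card_insert_erase hV.2 hj, smul_add, smul_smul, smul_smul,
      ← ENNReal.ofReal_mul (by positivity), ← ENNReal.ofReal_mul (by positivity)]
    congr 3 <;> field_simp
  rw [Finset.sum_congr rfl fun V hV => Finset.sum_congr rfl (h1 V hV)]
  simp only [Finset.sum_add_distrib]
  rw [sum_swap_mem_notMem i fun V => ENNReal.ofReal (w V.card / V.card) • g V,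
    add_right_comm]
  have hsplit : ∑ V ∈ batches n, ENNReal.ofReal (w V.card) • g V =
      ∑ V with i ∈ V, ENNReal.ofReal (w V.card) • g V +
        ∑ V : Finset (Fin n) with i ∉ V, if V.Nonempty then ENNReal.ofReal (w V.card) • g V else 0 := by
    rw [batches, Finset.sum_filter, ← Finset.sum_filter_add_sum_filter_not Finset.univ (i ∈ ·)]
    congr 1
    exact Finset.sum_congr rfl fun V hV => if_pos ⟨i, (Finset.mem_filter.1 hV).2⟩
  rw [hsplit]
  congr 1
  -- The full batch has no outside index to swap in, so it is the separate last summand.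
  · have hu : Finset.univ ∈ Finset.univ.filter (fun V : Finset (Fin n) => i ∈ V) := by simp
    rw [← Finset.sum_erase_add _ _ hu, ← Finset.sum_erase_add _ _ hu]
    simp only [Finset.compl_univ, Finset.sum_empty, add_zero, Finset.card_fin]
    congr 1
    refine Finset.sum_congr rfl fun V hV => ?_
    rw [Finset.mem_erase] at hV
    obtain ⟨j, hj⟩ : ∃ j, j ∉ V := by
      by_contra! h
      exact hV.1 (Finset.eq_univ_iff_forall.2 h)
    have h3 := hlt V j hj
    rw [Finset.sum_const, Finset.card_compl, Fintype.card_fin, ← Nat.cast_smul_eq_nsmul ℝ≥0∞,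
      smul_smul, ← ENNReal.ofReal_natCast, ← ENNReal.ofReal_mul (by positivity),
      Nat.cast_sub (by simpa using V.card_le_univ)]
    congr 2
    field_simp
  · refine Finset.sum_congr rfl fun V _ => ?_
    rw [Finset.sum_const]
    split_ifs with hV
    · have h2 : (0 : ℝ) < V.card := by exact_mod_cast Finset.card_pos.2 hV
      rw [← Nat.cast_smul_eq_nsmul ℝ≥0∞, smul_smul, ← ENNReal.ofReal_natCast,
        ← ENNReal.ofReal_mul (by positivity)]
      congr 2
      field_simp
    · simp [Finset.not_nonempty_iff_eq_empty.1 hV]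

variable {q : ℝ}

theorem batchProb_nonneg (hq : 0 ≤ q) (hq1 : q ≤ 1) (V : Finset (Fin n)) :
    0 ≤ batchProb n q V := by
  have h1 : 0 ≤ 1 - q := by linarith
  have h2 : (1 - q) ^ n ≤ 1 := pow_le_one₀ h1 (by linarith)
  exact div_nonneg (by positivity) (by linarith)

theorem sum_batchProb (hn : n ≠ 0) (hq : 0 < q) (hq1 : q ≤ 1) :
    ∑ V ∈ batches n, batchProb n q V = 1 := by
  have h : (1 - q) ^ n < 1 := pow_lt_one₀ (by linarith) (by linarith) hn
  have h1 := Fin.sum_pow_mul_eq_add_pow (n := n) q (1 - q)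
  rw [add_sub_cancel, one_pow, ← Finset.add_sum_erase _ _ (Finset.mem_univ ∅)] at h1
  have h2 : batches n = Finset.univ.erase ∅ := by
    ext V
    simp [batches, Finset.nonempty_iff_ne_empty]
  simp only [batchProb]
  rw [← Finset.sum_div, h2, div_eq_one_iff_eq (by linarith)]
  simp only [Finset.card_empty, pow_zero, one_mul, Nat.sub_zero] at h1
  linarith

theorem sum_ofReal_batchProb (hn : n ≠ 0) (hq : 0 < q) (hq1 : q ≤ 1) :
    ∑ V ∈ batches n, ENNReal.ofReal (batchProb n q V) = 1 := by
  rw [← ENNReal.ofReal_sum_of_nonneg fun V _ => batchProb_nonneg hq.le hq1 V,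
    sum_batchProb hn hq hq1, ENNReal.ofReal_one]

theorem MomentBound.batches {α : Type*} [MeasurableSpace α] {b : ℕ} (hq : 0 ≤ q) (hq1 : q ≤ 1)
    (i : Fin n) {μ ν : Finset (Fin n) → Measure α} {A : ℝ → ℝ≥0∞}
    (h : ∀ V, i ∈ V → ∀ j, j ∉ V → MomentBound b
      (ENNReal.ofReal (V.card / n) • μ V +
        ENNReal.ofReal (1 - V.card / n) • μ (insert j (V.erase i)))
      (ENNReal.ofReal (V.card / n) • ν V +
        ENNReal.ofReal (1 - V.card / n) • ν (insert j (V.erase i)))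
      (A (V.card / n)))
    (huniv : MomentBound b (μ Finset.univ) (ν Finset.univ) (A 1)) :
    MomentBound b (∑ V ∈ batches n, ENNReal.ofReal (batchProb n q V) • μ V)
      (∑ V ∈ batches n, ENNReal.ofReal (batchProb n q V) • ν V)
      (∑ V ∈ batches n, ENNReal.ofReal (batchProb n q V) * A (V.card / n)) := by
  have hn : (0 : ℝ) < n := by exact_mod_cast i.pos
  set w : ℕ → ℝ := fun k => q ^ k * (1 - q) ^ (n - k) / (1 - (1 - q) ^ n) with hwdef
  have hw : ∀ k, 0 ≤ w k := fun k => by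
    have h1 : 0 ≤ 1 - q := by linarith
    have h2 : (1 - q) ^ n ≤ 1 := pow_le_one₀ h1 (by linarith)
    exact div_nonneg (by positivity) (by linarith)
  have hb : ∀ V, batchProb n q V = w V.card := fun V => rfl
  simp only [hb]
  have hA := sum_batches_eq i w hw fun V : Finset (Fin n) => A (V.card / n)
  simp only [smul_eq_mul] at hA
  rw [sum_batches_eq i w hw μ, sum_batches_eq i w hw ν, hA]
  refine .add (.sum _ fun V hV => .sum _ fun j hj => ?_) ?_
  · rw [Finset.mem_filter] at hV
    rw [Finset.mem_compl] at hj
    rw [card_insert_erase hV.2 hj, ← add_mul, ← ENNReal.ofReal_add (by positivity), add_sub_cancel,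
      ENNReal.ofReal_one, one_mul]
    · exact (h V hV.2 j hj).smul _
    · rw [sub_nonneg, div_le_one hn]
      exact_mod_cast by simpa using V.card_le_univ
  · simpa [div_self hn.ne'] using huniv.smul (ENNReal.ofReal (w n))

end Batches

/-! ### Group normalization -/

namespace NormalizationLayer

theorem abs_div_sub_div_le {α R R' ρ ρ' : ℝ} (hα : 0 < α) (hR' : 0 ≤ R') (hRR : R' ≤ R)
    (hρ' : α ≤ ρ') (hρρ : ρ' ≤ ρ) (h : R' * ρ ≤ R * ρ') :
    |R / ρ - R' / ρ'| ≤ (R - R') / α := by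
  have h1 : 0 < ρ' := hα.trans_le hρ'
  have h2 : 0 < ρ := h1.trans_le hρρ
  rw [abs_of_nonneg (sub_nonneg.2 ((div_le_div_iff₀ h1 h2).2 h))]
  have : R / ρ ≤ R / ρ' := by
    have := hR'.trans hRR
    gcongr
  calc R / ρ - R' / ρ' ≤ R / ρ' - R' / ρ' := by linarith
    _ = (R - R') / ρ' := by ring
    _ ≤ (R - R') / α := by gcongr

/-- Cross-multiplied form of the fact that the radial profile `R / max α √(R²/c + κ)` is
nondecreasing. -/
theorem mul_max_sqrt_le {α κ c R R' : ℝ} (hα : 0 < α) (hκ : 0 ≤ κ) (hR' : 0 ≤ R')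
    (hRR : R' ≤ R) :
    R' * max α (Real.sqrt (R ^ 2 / c + κ)) ≤ R * max α (Real.sqrt (R' ^ 2 / c + κ)) := by
  have hR : 0 ≤ R := hR'.trans hRR
  rw [mul_max_of_nonneg _ _ hR']
  refine max_le ?_ ?_
  · exact mul_le_mul hRR (le_max_left _ _) hα.le hR
  · refine le_trans ?_ (mul_le_mul_of_nonneg_left (le_max_right _ _) hR)
    rw [← Real.sqrt_sq hR', ← Real.sqrt_sq hR, ← Real.sqrt_mul (sq_nonneg _),
      ← Real.sqrt_mul (sq_nonneg _), Real.sqrt_sq hR', Real.sqrt_sq hR]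
    refine Real.sqrt_le_sqrt ?_
    have : R' ^ 2 * κ ≤ R ^ 2 * κ := by gcongr
    calc R' ^ 2 * (R ^ 2 / c + κ) = R ^ 2 * R' ^ 2 / c + R' ^ 2 * κ := by ring
      _ ≤ R ^ 2 * R' ^ 2 / c + R ^ 2 * κ := by gcongr
      _ = _ := by ring

variable {ι : Type*}

/-- Centering is an orthogonal projection, so it does not increase the norm. -/
theorem sum_sub_mean_sq_le (S : Finset ι) (x : ι → ℝ) :
    ∑ j ∈ S, (x j - (∑ i ∈ S, x i) / S.card) ^ 2 ≤ ∑ j ∈ S, x j ^ 2 := by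
  rcases S.eq_empty_or_nonempty with rfl | hS
  · simp
  have hc : (0 : ℝ) < S.card := by exact_mod_cast hS.card_pos
  obtain ⟨m, hm⟩ : ∃ m, m = (∑ i ∈ S, x i) / S.card := ⟨_, rfl⟩
  have h1 : ∑ j ∈ S, x j = S.card * m := by rw [hm, mul_div_cancel₀ _ hc.ne']
  rw [← hm]
  have h2 : ∑ j ∈ S, (x j - m) ^ 2 = ∑ j ∈ S, x j ^ 2 - S.card * m ^ 2 := by
    calc ∑ j ∈ S, (x j - m) ^ 2 = ∑ j ∈ S, (x j ^ 2 - 2 * m * x j + m ^ 2) :=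
          Finset.sum_congr rfl fun j _ => by ring
      _ = ∑ j ∈ S, x j ^ 2 - 2 * m * ∑ j ∈ S, x j + S.card * m ^ 2 := by
        rw [Finset.sum_add_distrib, Finset.sum_sub_distrib, Finset.mul_sum, Finset.sum_const,
          nsmul_eq_mul]
      _ = _ := by rw [h1]; ring
  rw [h2]
  have : 0 ≤ S.card * m ^ 2 := mul_nonneg (Nat.cast_nonneg _) (sq_nonneg _)
  linarith

/-- After centering, normalization only rescales radially. With `R`, `R'` the norms and `ρ`, `ρ'`
the divisors, the squared distance of the images is `(R/ρ - R'/ρ')² + 2 (R R' - ⟨v, w⟩) / (ρ ρ')`.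
The radial part is controlled by monotonicity of `R / ρ`, the angular part by Cauchy–Schwarz and `ρ,
ρ' ≥ α`. -/
theorem sum_sq_div_sub_div_le {α κ : ℝ} (hα : 0 < α) (hκ : 0 ≤ κ) (c : ℝ) (hc : 0 ≤ c)
    (S : Finset ι) (v w : ι → ℝ) :
    ∑ j ∈ S, (v j / max α (Real.sqrt ((∑ i ∈ S, v i ^ 2) / c + κ)) -
      w j / max α (Real.sqrt ((∑ i ∈ S, w i ^ 2) / c + κ))) ^ 2 ≤
      (1 / α) ^ 2 * ∑ j ∈ S, (v j - w j) ^ 2 := by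
  wlog hvw : ∑ i ∈ S, w i ^ 2 ≤ ∑ i ∈ S, v i ^ 2 generalizing v w
  · have := this w v (le_of_not_ge hvw)
    simpa only [sub_sq_comm] using this
  have expand : ∀ a b : ℝ, ∑ j ∈ S, (v j * a - w j * b) ^ 2 = a ^ 2 * ∑ j ∈ S, v j ^ 2 +
      b ^ 2 * ∑ j ∈ S, w j ^ 2 - 2 * (a * b) * ∑ j ∈ S, v j * w j := by
    intro a b
    rw [Finset.mul_sum, Finset.mul_sum, Finset.mul_sum, ← Finset.sum_add_distrib,
      ← Finset.sum_sub_distrib]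
    exact Finset.sum_congr rfl fun j _ => by ring
  have hcs := Finset.sum_mul_sq_le_sq_mul_sq S v w
  have e1 := expand 1 1
  simp only [mul_one] at e1
  simp only [div_eq_mul_inv (v _), div_eq_mul_inv (w _)]
  rw [expand, e1]
  set I := ∑ j ∈ S, v j * w j
  have hV0 : 0 ≤ ∑ j ∈ S, v j ^ 2 := Finset.sum_nonneg fun j _ => sq_nonneg _
  have hW0 : 0 ≤ ∑ j ∈ S, w j ^ 2 := Finset.sum_nonneg fun j _ => sq_nonneg _
  obtain ⟨R, hR, hRV⟩ : ∃ R, 0 ≤ R ∧ ∑ j ∈ S, v j ^ 2 = R ^ 2 :=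
    ⟨_, Real.sqrt_nonneg _, (Real.sq_sqrt hV0).symm⟩
  obtain ⟨R', hR', hRW⟩ : ∃ R, 0 ≤ R ∧ ∑ j ∈ S, w j ^ 2 = R ^ 2 :=
    ⟨_, Real.sqrt_nonneg _, (Real.sq_sqrt hW0).symm⟩
  rw [hRV, hRW] at hvw hcs ⊢
  have hRR : R' ≤ R := le_of_sq_le_sq hvw hR
  have hI : I ≤ R * R' := by
    refine (le_abs_self I).trans (abs_le_of_sq_le_sq ?_ (by positivity))
    nlinarith
  have hρ : α ≤ max α (Real.sqrt (R' ^ 2 / c + κ)) := le_max_left _ _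
  have hρρ : max α (Real.sqrt (R' ^ 2 / c + κ)) ≤ max α (Real.sqrt (R ^ 2 / c + κ)) := by
    gcongr
  have key := abs_div_sub_div_le hα hR' hRR hρ hρρ (mul_max_sqrt_le hα hκ hR' hRR)
  set ρ := max α (Real.sqrt (R ^ 2 / c + κ))
  set ρ' := max α (Real.sqrt (R' ^ 2 / c + κ))
  have key2 : (R / ρ - R' / ρ') ^ 2 ≤ ((R - R') / α) ^ 2 := sq_le_sq' (by
    linarith [neg_abs_le (R / ρ - R' / ρ')]) ((le_abs_self _).trans key)
  have h3 : ρ⁻¹ * ρ'⁻¹ ≤ (1 / α) ^ 2 := by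
    rw [one_div, sq]
    gcongr
    exact hρ.trans hρρ
  have h4 : ρ⁻¹ * ρ'⁻¹ * (2 * (R * R' - I)) ≤ (1 / α) ^ 2 * (2 * (R * R' - I)) := by
    gcongr
  calc _ = (R / ρ - R' / ρ') ^ 2 + ρ⁻¹ * ρ'⁻¹ * (2 * (R * R' - I)) := by
        rw [div_eq_mul_inv, div_eq_mul_inv]; ring
    _ ≤ ((R - R') / α) ^ 2 + (1 / α) ^ 2 * (2 * (R * R' - I)) := add_le_add key2 h4
    _ = _ := by rw [div_eq_mul_one_div]; ring

variable {n : ℕ} (L : NormalizationLayer n)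

theorem sum_eq_sum_groups (g : Fin n → ℝ) :
    ∑ j, g j = ∑ a, ∑ j with L.grp j = a, g j :=
  (Finset.sum_fiberwise _ _ _).symm

theorem f_apply {a : Fin L.G} {j : Fin n} (hj : L.grp j = a) (x : Vec n) :
    L.f x j = (x j - (∑ i with L.grp i = a, x i) / (Finset.univ.filter (L.grp · = a)).card) /
      max L.α (Real.sqrt ((∑ i with L.grp i = a, (x i - (∑ i with L.grp i = a, x i) /
        (Finset.univ.filter (L.grp · = a)).card) ^ 2) /
        (Finset.univ.filter (L.grp · = a)).card + L.κ)) := by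
  subst hj
  rfl

theorem norm_f_sub_le (x y : Vec n) : ‖L.f x - L.f y‖ ≤ 1 / L.α * ‖x - y‖ := by
  have hα := L.α_pos
  refine le_of_sq_le_sq ?_ (by positivity)
  rw [mul_pow, EuclideanSpace.real_norm_sq_eq, EuclideanSpace.real_norm_sq_eq,
    L.sum_eq_sum_groups, L.sum_eq_sum_groups, Finset.mul_sum]
  refine Finset.sum_le_sum fun a _ => ?_
  set S := Finset.univ.filter (L.grp · = a) with hS
  have h1 := sum_sq_div_sub_div_le hα L.κ_nonneg S.card (by positivity) S
    (fun j => x j - (∑ i ∈ S, x i) / S.card) (fun j => y j - (∑ i ∈ S, y i) / S.card)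
  have h2 := sum_sub_mean_sq_le S (fun j => x j - y j)
  calc _ = _ := Finset.sum_congr rfl fun j hj => by
        rw [PiLp.sub_apply, L.f_apply (Finset.mem_filter.1 hj).2,
          L.f_apply (Finset.mem_filter.1 hj).2]
    _ ≤ _ := h1
    _ = (1 / L.α) ^ 2 * ∑ j ∈ S, ((x j - y j) - (∑ i ∈ S, (x i - y i)) / S.card) ^ 2 := by
        congr 1
        refine Finset.sum_congr rfl fun j _ => ?_
        rw [Finset.sum_sub_distrib]
        ring
    _ ≤ _ := mul_le_mul_of_nonneg_left h2 (sq_nonneg _)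

theorem f_zero : L.f 0 = 0 := by
  ext j
  simp [f, mean]

theorem norm_f_le (x : Vec n) : ‖L.f x‖ ≤ Real.sqrt n := by
  refine Real.le_sqrt_of_sq_le ?_
  have hn : (n : ℝ) = ∑ _j : Fin n, (1 : ℝ) := by simp
  rw [EuclideanSpace.real_norm_sq_eq, hn, L.sum_eq_sum_groups, L.sum_eq_sum_groups]
  refine Finset.sum_le_sum fun a _ => ?_
  rw [Finset.sum_congr rfl fun j hj => by rw [L.f_apply (Finset.mem_filter.1 hj).2]]
  set S := Finset.univ.filter (L.grp · = a) with hS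
  set m := (∑ i ∈ S, x i) / S.card
  set W := ∑ j ∈ S, (x j - m) ^ 2
  have hW0 : 0 ≤ W := Finset.sum_nonneg fun j _ => sq_nonneg _
  set ρ := max L.α (Real.sqrt (W / S.card + L.κ))
  have hρ : 0 < ρ := L.α_pos.trans_le (le_max_left _ _)
  have hκ := L.κ_nonneg
  simp only [div_pow]
  rw [← Finset.sum_div, Finset.sum_const, nsmul_one, div_le_iff₀ (by positivity)]
  rcases S.eq_empty_or_nonempty with h | h
  · have : W = 0 := by simp only [W, h, Finset.sum_empty]
    change W ≤ _
    rw [this]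
    positivity
  · have hc : (0 : ℝ) < S.card := by exact_mod_cast h.card_pos
    have h1 : W / S.card + L.κ ≤ ρ ^ 2 := by
      rw [← Real.sq_sqrt (show 0 ≤ W / S.card + L.κ by positivity)]
      gcongr
      exact le_max_right _ _
    have h2 : W / S.card ≤ ρ ^ 2 := by linarith
    rw [div_le_iff₀ hc] at h2
    linarith

end NormalizationLayer

/-! ### Layers -/

namespace Layer

variable {n m : ℕ} (L : Layer n m)

theorem lipInput_nonneg (u : ℝ) : 0 ≤ L.lipInput u := by
  cases L with
  | trainable L => exact NNReal.coe_nonneg _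
  | activation L => exact NNReal.coe_nonneg _
  | normalization L => exact (one_div_pos.2 L.α_pos).le

theorem lipParam_nonneg (X : ℝ) : 0 ≤ L.lipParam X := by
  cases L with
  | trainable L => exact NNReal.coe_nonneg _
  | activation L => exact le_rfl
  | normalization L => exact le_rfl

theorem measurable_lipInput : Measurable L.lipInput := by
  cases L with
  | trainable L => exact L.measurable_lipInput.coe_nnreal_real
  | activation L => exact measurable_const
  | normalization L => exact measurable_const

theorem measurable_lipParam : Measurable L.lipParam := by
  cases L with
  | trainable L => exact L.measurable_lipParam.coe_nnreal_real
  | activation L => exact measurable_const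
  | normalization L => exact measurable_const

theorem measurable_nextBound {α : Type*} [MeasurableSpace α] {u X : α → ℝ} (hu : Measurable u)
    (hX : Measurable X) : Measurable fun a => L.nextBound (u a) (X a) := by
  cases L with
  | trainable L => exact (((hX.pow_const 2).add_const _).sqrt).mul hu
  | activation L => exact (hX.mul_const _).const_add _
  | normalization L => exact measurable_const.min (hX.div_const _)

theorem pnorm_smul (c : ℝ) (θ : Vec L.paramDim) : L.pnorm (c • θ) = |c| * L.pnorm θ := by
  cases L with
  | trainable L => exact map_smul_eq_mul L.pnorm c θ
  | activation L => exact (mul_zero _).symm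
  | normalization L => exact (mul_zero _).symm

theorem pnorm_nonneg (θ : Vec L.paramDim) : 0 ≤ L.pnorm θ := by
  cases L with
  | trainable L => exact apply_nonneg L.pnorm θ
  | activation L => exact le_rfl
  | normalization L => exact le_rfl

theorem measurable_pnorm : Measurable L.pnorm := by
  cases L with
  | trainable L =>
    -- A seminorm is convex, and convex functions on a finite-dimensional space are continuous.
    exact (continuousOn_univ.1 (L.pnorm.convexOn.continuousOn isOpen_univ)).measurable
  | activation L => exact measurable_const
  | normalization L => exact measurable_const

theorem norm_apply_sub_le {θ : Vec L.paramDim} {u : ℝ} (h : L.pnorm θ ≤ u) (x y : Vec n) :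
    ‖L.apply θ x - L.apply θ y‖ ≤ L.lipInput u * ‖x - y‖ := by
  cases L with
  | trainable L => exact (L.lipschitz_input θ u h).norm_sub_le x y
  | activation L => exact L.lipschitz.norm_sub_le x y
  | normalization L => exact L.norm_f_sub_le x y

theorem norm_apply_sub_le_param {x : Vec n} {X : ℝ} (h : ‖x‖ ≤ X) (θ θ' : Vec L.paramDim) :
    ‖L.apply θ x - L.apply θ' x‖ ≤ L.lipParam X * ‖θ - θ'‖ := by
  cases L with
  | trainable L => exact (L.lipschitz_param x X h).norm_sub_le θ θ'
  | activation L => simp [apply, lipParam]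
  | normalization L => simp [apply, lipParam]

theorem norm_apply_le {θ : Vec L.paramDim} {u X : ℝ} (h : L.pnorm θ ≤ u) {x : Vec n}
    (hx : ‖x‖ ≤ X) : ‖L.apply θ x‖ ≤ L.nextBound u X := by
  cases L with
  | trainable L =>
    refine (L.norm_le θ x).trans ?_
    have h0 : 0 ≤ L.pnorm θ := apply_nonneg _ _
    have h' : L.pnorm θ ≤ u := h
    change _ ≤ Real.sqrt (X ^ 2 + (L.offset : ℝ) ^ 2) * u
    rw [mul_comm]
    gcongr
  | activation L =>
    change ‖L.f x‖ ≤ ‖L.f 0‖ + X * L.lip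
    have h1 := L.lipschitz.norm_sub_le x 0
    have h2 := norm_sub_norm_le (L.f x) (L.f 0)
    rw [sub_zero] at h1
    have h3 : (L.lip : ℝ) * ‖x‖ ≤ X * L.lip := by rw [mul_comm]; gcongr
    linarith
  | normalization L =>
    have hα := L.α_pos
    refine le_min (L.norm_f_le x) ?_
    have h1 := L.norm_f_sub_le x 0
    rw [L.f_zero, sub_zero, sub_zero] at h1
    refine h1.trans ?_
    rw [one_div_mul_eq_div]
    gcongr

/-- Passing through `(θ, q.2)` evaluates the Lipschitz bounds only at the fixed values `‖x‖ + 1` and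
`pnorm θ`, so these bounds need not be continuous. Joint continuity is used to make the gradient
measurable in `θ`. -/
theorem continuous_apply : Continuous fun q : Vec L.paramDim × Vec n => L.apply q.1 q.2 := by
  rw [continuous_iff_continuousAt]
  rintro ⟨θ, x⟩
  rw [ContinuousAt, tendsto_iff_norm_sub_tendsto_zero]
  have hlim : Filter.Tendsto (fun q : Vec L.paramDim × Vec n =>
      L.lipParam (‖x‖ + 1) * ‖q.1 - θ‖ + L.lipInput (L.pnorm θ) * ‖q.2 - x‖) (nhds (θ, x))
      (nhds 0) := by
    have : Continuous (fun q : Vec L.paramDim × Vec n =>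
      L.lipParam (‖x‖ + 1) * ‖q.1 - θ‖ + L.lipInput (L.pnorm θ) * ‖q.2 - x‖) := by fun_prop
    simpa using this.tendsto (θ, x)
  refine squeeze_zero' (.of_forall fun _ => norm_nonneg _) ?_ hlim
  have hev : ∀ᶠ q : Vec L.paramDim × Vec n in nhds (θ, x), ‖q.2‖ < ‖x‖ + 1 :=
    (continuous_snd.norm.tendsto (θ, x)).eventually (gt_mem_nhds (lt_add_one _))
  filter_upwards [hev] with q hq
  calc _ = ‖(L.apply q.1 q.2 - L.apply θ q.2) + (L.apply θ q.2 - L.apply θ x)‖ := by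
        congr 1; abel
    _ ≤ _ := (norm_add_le _ _).trans (add_le_add (L.norm_apply_sub_le_param hq.le _ _)
        (L.norm_apply_sub_le le_rfl _ _))

end Layer

/-! ### Sensitivity of the gradients of a network -/

namespace Network

variable (N : Network)

theorem norm_act_le {θ : N.Params} {u : Fin N.K → ℝ} (hθ : ∀ k, (N.layer k).pnorm (θ k) ≤ u k)
    {x : Vec (N.dim 0)} {X₁ : ℝ} (hx : ‖x‖ ≤ X₁) :
    ∀ (k : ℕ) (h : k ≤ N.K), ‖N.act θ x k h‖ ≤ N.inputBound u X₁ k h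
  | 0, _ => hx
  | k + 1, _ => (N.layer _).norm_apply_le (hθ _) (norm_act_le hθ hx k _)

theorem act_update (θ : N.Params) (x : Vec (N.dim 0)) (i : Fin N.K)
    (w : Vec (N.layer i).paramDim) :
    ∀ (k : ℕ) (h : k ≤ N.K), k ≤ i → N.act (Function.update θ i w) x k h = N.act θ x k h
  | 0, _, _ => rfl
  | k + 1, h, hk => by
    have : (⟨k, h⟩ : Fin N.K) ≠ i := fun e => by
      have := congrArg Fin.val e
      simp only at this
      omega
    rw [act, act, act_update θ x i w k _ (by omega), Function.update_of_ne this]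

theorem backLip_of_lt (u : Fin N.K → ℝ) (l : ℝ) (k : Fin N.K) :
    N.backLip u l k = N.backLip u l (k + 1) * (N.layer k).lipInput (u k) := by
  rw [backLip, dif_pos k.isLt]

theorem backLip_self (u : Fin N.K → ℝ) (l : ℝ) : N.backLip u l N.K = l := by
  rw [backLip, dif_neg (lt_irrefl _)]

theorem backLip_nonneg (u : Fin N.K → ℝ) {l : ℝ} (hl : 0 ≤ l) (k : ℕ) : 0 ≤ N.backLip u l k := by
  induction k using backLip.induct N with
  | case1 k h ih => rw [backLip, dif_pos h]; exact mul_nonneg ih (Layer.lipInput_nonneg _ _)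
  | case2 k h => rw [backLip, dif_neg h]; exact hl

/-- The left-hand side does not increase with `j`: each further layer spends one factor of
`backLip`. Only the other layers need clipped parameters; `w` and `w'` are arbitrary, as
differentiation at `θ i` requires. -/
theorem backLip_mul_norm_act_sub_le {θ : N.Params} {u : Fin N.K → ℝ}
    (hθ : ∀ k, (N.layer k).pnorm (θ k) ≤ u k) {x : Vec (N.dim 0)} {X₁ : ℝ} (hx : ‖x‖ ≤ X₁)
    {l : ℝ} (hl : 0 ≤ l) (i : Fin N.K) (w w' : Vec (N.layer i).paramDim) (j : ℕ) (hij : i + 1 ≤ j) :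
    ∀ h : j ≤ N.K, N.backLip u l j *
      ‖N.act (Function.update θ i w) x j h - N.act (Function.update θ i w') x j h‖ ≤
        N.layerSensitivity u X₁ l i * ‖w - w'‖ := by
  induction j, hij using Nat.le_induction with
  | base =>
    intro h
    rw [layerSensitivity, mul_assoc]
    refine mul_le_mul_of_nonneg_left ?_ (N.backLip_nonneg u hl _)
    rw [act, act, N.act_update θ x i w _ _ le_rfl, N.act_update θ x i w' _ _ le_rfl,
      Function.update_self, Function.update_self]
    exact (N.layer i).norm_apply_sub_le_param (N.norm_act_le hθ hx _ _) w w'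
  | succ j hij ih =>
    intro h
    have hne : (⟨j, h⟩ : Fin N.K) ≠ i := fun e => by
      have := congrArg Fin.val e
      simp only at this
      omega
    refine le_trans ?_ (ih (Nat.le_of_succ_le h))
    rw [N.backLip_of_lt u l ⟨j, h⟩, mul_assoc]
    refine mul_le_mul_of_nonneg_left ?_ (N.backLip_nonneg u hl _)
    rw [act, act, Function.update_of_ne hne, Function.update_of_ne hne]
    exact (N.layer _).norm_apply_sub_le (hθ _) _ _

variable {Y : Type*} {ℓ : Vec (N.dim N.K) → Y → ℝ} {l : ℝ≥0}

theorem norm_loss_sub_le (hℓ : ∀ y, LipschitzWith l (fun v => ℓ v y)) {θ : N.Params}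
    {u : Fin N.K → ℝ} (hθ : ∀ k, (N.layer k).pnorm (θ k) ≤ u k) {x : Vec (N.dim 0)} {X₁ : ℝ}
    (hx : ‖x‖ ≤ X₁) (y : Y) (i : Fin N.K) (w w' : Vec (N.layer i).paramDim) :
    ‖ℓ (N.eval (Function.update θ i w) x) y - ℓ (N.eval (Function.update θ i w') x) y‖ ≤
      N.layerSensitivity u X₁ l i * ‖w - w'‖ := by
  have := N.backLip_mul_norm_act_sub_le hθ hx l.coe_nonneg i w w' N.K i.isLt le_rfl
  rw [N.backLip_self] at this
  exact ((hℓ y).norm_sub_le _ _).trans this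

theorem layerSensitivity_nonneg (u : Fin N.K → ℝ) (X₁ : ℝ) {l : ℝ} (hl : 0 ≤ l) (k : Fin N.K) :
    0 ≤ N.layerSensitivity u X₁ l k :=
  mul_nonneg (N.backLip_nonneg u hl _) (Layer.lipParam_nonneg _ _)

/-- A derivative is bounded by a Lipschitz constant; the default value 0 at non-differentiable
points also obeys the bound. -/
theorem norm_lossGrad_le (hℓ : ∀ y, LipschitzWith l (fun v => ℓ v y)) {θ : N.Params}
    {u : Fin N.K → ℝ} (hθ : ∀ k, (N.layer k).pnorm (θ k) ≤ u k) {x : Vec (N.dim 0)} {X₁ : ℝ}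
    (hx : ‖x‖ ≤ X₁) (y : Y) (k : Fin N.K) :
    ‖N.lossGrad ℓ θ x y k‖ ≤ N.layerSensitivity u X₁ l k := by
  have h0 := N.layerSensitivity_nonneg u X₁ l.coe_nonneg k
  have hlip : LipschitzWith ⟨_, h0⟩ fun w => ℓ (N.eval (Function.update θ k w) x) y :=
    LipschitzWith.of_dist_le_mul fun w w' => by
      rw [dist_eq_norm, dist_eq_norm]
      exact N.norm_loss_sub_le hℓ hθ hx y k w w'
  rw [lossGrad, gradient, LinearIsometryEquiv.norm_map]
  exact norm_fderiv_le_of_lipschitz ℝ hlip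

/-! ### Clipping -/

variable {N}

theorem pnorm_clipParams_le {C : ℝ} (hC : 0 ≤ C) (θ : N.Params) (k : Fin N.K) :
    (N.layer k).pnorm (N.clipParams C θ k) ≤ N.clipNorms C θ k := by
  have h0 := (N.layer k).pnorm_nonneg (θ k)
  have h1 : 0 ≤ N.clipNorms C θ k := le_min hC h0
  rw [clipParams, Layer.pnorm_smul, abs_of_nonneg (div_nonneg h1 h0)]
  -- If the norm vanishes, the division by zero returns 0 and the parameters become 0, as the
  -- algorithm prescribes.
  rcases h0.eq_or_lt with h | h
  · rw [← h]
    simpa using h1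
  · rw [div_mul_cancel₀ _ h.ne']

/-! ### Measurability -/

variable (N)

theorem measurable_clipNorms (C : ℝ) : Measurable (N.clipNorms C) :=
  measurable_pi_lambda _ fun k =>
    measurable_const.min ((N.layer k).measurable_pnorm.comp (measurable_pi_apply k))

theorem measurable_clipParams (C : ℝ) : Measurable (N.clipParams C) := by
  refine measurable_pi_lambda _ fun k => ?_
  have h1 : Measurable fun θ : N.Params => N.clipNorms C θ k :=
    (measurable_pi_apply k).comp (N.measurable_clipNorms C)
  have h2 : Measurable fun θ : N.Params => (N.layer k).pnorm (θ k) :=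
    (N.layer k).measurable_pnorm.comp (measurable_pi_apply k)
  exact (h1.div h2).smul (measurable_pi_apply k)

theorem measurable_inputBound (X₁ : ℝ) :
    ∀ (k : ℕ) (h : k ≤ N.K), Measurable fun u : Fin N.K → ℝ => N.inputBound u X₁ k h
  | 0, _ => measurable_const
  | k + 1, _ => Layer.measurable_nextBound _ (measurable_pi_apply _) (measurable_inputBound X₁ k _)

theorem measurable_backLip (l : ℝ) (k : ℕ) :
    Measurable fun u : Fin N.K → ℝ => N.backLip u l k := by
  induction k using backLip.induct N with
  | case1 k h ih =>
    have : (fun u : Fin N.K → ℝ => N.backLip u l k) =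
        fun u => N.backLip u l (k + 1) * (N.layer ⟨k, h⟩).lipInput (u ⟨k, h⟩) :=
      funext fun u => N.backLip_of_lt u l ⟨k, h⟩
    rw [this]
    exact ih.mul ((Layer.measurable_lipInput _).comp (measurable_pi_apply _))
  | case2 k h =>
    have : (fun u : Fin N.K → ℝ => N.backLip u l k) = fun _ => l :=
      funext fun u => by rw [backLip, dif_neg h]
    rw [this]
    exact measurable_const

theorem measurable_layerSensitivity (X₁ l : ℝ) (k : Fin N.K) :
    Measurable fun u : Fin N.K → ℝ => N.layerSensitivity u X₁ l k :=
  (N.measurable_backLip l _).mul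
    ((Layer.measurable_lipParam _).comp (N.measurable_inputBound X₁ _ _))

theorem continuous_act (x : Vec (N.dim 0)) :
    ∀ (k : ℕ) (h : k ≤ N.K), Continuous fun θ : N.Params => N.act θ x k h
  | 0, _ => continuous_const
  | k + 1, h => (Layer.continuous_apply (N.layer ⟨k, h⟩)).comp
      ((continuous_apply (⟨k, h⟩ : Fin N.K)).prodMk (continuous_act x k _))

theorem measurable_lossGrad (hℓ : ∀ y, LipschitzWith l (fun v => ℓ v y)) (x : Vec (N.dim 0))
    (y : Y) (k : Fin N.K) : Measurable fun θ : N.Params => N.lossGrad ℓ θ x y k := by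
  have hcont : Continuous (Function.uncurry fun (θ : N.Params) (w : Vec (N.layer k).paramDim) =>
      ℓ (N.eval (Function.update θ k w) x) y) :=
    (hℓ y).continuous.comp ((N.continuous_act x N.K le_rfl).comp
      (continuous_fst.update k continuous_snd))
  have := (measurable_fderiv_with_param ℝ hcont).comp
    (measurable_id.prodMk (measurable_pi_apply k))
  exact ((InnerProductSpace.toDual ℝ _).symm.continuous.measurable).comp this

end Network

theorem gaussRatioSq_nonneg (m : ℕ) (σ : ℝ) : 0 ≤ gaussRatioSq m σ := by
  unfold gaussRatioSq
  positivity

namespace Network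

variable (N : Network)

/-! ### The noise as a standard Gaussian vector -/

/-- The index set of all scalar parameters. -/
abbrev ParamIndex : Type := (k : Fin N.K) × Fin (N.layer k).paramDim

/-- The parameters with given scalar coordinates. -/
def unflatten (ξ : N.ParamIndex → ℝ) : N.Params := fun k => WithLp.toLp 2 fun j => ξ ⟨k, j⟩

theorem measurable_unflatten : Measurable N.unflatten :=
  measurable_pi_lambda _ fun _ => (WithLp.measurable_toLp 2 _).comp
    (measurable_pi_lambda _ fun _ => measurable_pi_apply _)

theorem measurable_smul_unflatten (c : Fin N.K → ℝ) :
    Measurable fun (ξ : N.ParamIndex → ℝ) k => c k • N.unflatten ξ k := by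
  refine measurable_pi_lambda _ fun k => ?_
  have h : Measurable fun ξ : N.ParamIndex → ℝ => N.unflatten ξ k :=
    (measurable_pi_apply k).comp N.measurable_unflatten
  exact h.const_smul (c k)

theorem map_unflatten_stdGauss : (stdGauss N.ParamIndex).map N.unflatten =
    Measure.pi fun k => stdGaussian (Vec (N.layer k).paramDim) := by
  have h1 := Measure.infinitePi_map_piCurry (X := fun (k : Fin N.K)
    (_ : Fin (N.layer k).paramDim) => ℝ) fun _ _ => gaussianReal 0 1
  simp only [Measure.infinitePi_eq_pi] at h1
  have h2 := Measure.pi_map_pi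
    (μ := fun k => Measure.pi fun _ : Fin (N.layer k).paramDim => gaussianReal 0 1)
    (f := fun k => WithLp.toLp 2) (Y := fun k => Vec (N.layer k).paramDim)
    (hμ := fun k => by rw [map_pi_eq_stdGaussian]; infer_instance)
    fun k => (WithLp.measurable_toLp 2 _).aemeasurable
  simp only [map_pi_eq_stdGaussian] at h2
  rw [← h2, ← h1, Measure.map_map _ (MeasurableEquiv.measurable _)]
  · rfl
  · exact measurable_pi_lambda _ fun k => (WithLp.measurable_toLp 2 _).comp (measurable_pi_apply k)

theorem noise_eq_map (σ : ℝ) (Δ : Fin N.K → ℝ) :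
    N.noise σ Δ = (stdGauss N.ParamIndex).map fun ξ k => (σ * Δ k) • N.unflatten ξ k := by
  have hm : Measurable fun (b : N.Params) k => (σ * Δ k) • b k :=
    measurable_pi_lambda _ fun k => (measurable_pi_apply k).const_smul (σ * Δ k)
  rw [noise, ← Measure.pi_map_pi fun k => (measurable_const_smul _).aemeasurable,
    ← map_unflatten_stdGauss, Measure.map_map hm N.measurable_unflatten]
  rfl

theorem sum_sq_le_gaussRatioSq {σ : ℝ} (hσ : 0 < σ) {Δ : Fin N.K → ℝ} (hΔ : ∀ k, 0 ≤ Δ k)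
    (D : N.Params) (hD : ∀ k, ‖D k‖ ≤ 2 * Δ k) :
    ∑ p : N.ParamIndex, ((σ * Δ p.1)⁻¹ * D p.1 p.2) ^ 2 ≤ gaussRatioSq N.numTrainable σ := by
  rw [Fintype.sum_sigma, gaussRatioSq, numTrainable]
  have h1 : ∀ k, ∑ j, ((σ * Δ k)⁻¹ * D k j) ^ 2 ≤
      if (N.layer k).paramDim ≠ 0 then 4 / σ ^ 2 else 0 := by
    intro k
    split_ifs with h
    · simp only [mul_pow]
      rw [← Finset.mul_sum, ← EuclideanSpace.real_norm_sq_eq, ← mul_pow]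
      -- When `Δ k = 0` the inverse is 0 by convention, and the layer contributes nothing.
      rcases (hΔ k).eq_or_lt with h0 | h0
      · rw [← h0]
        simp
        positivity
      · have : (σ * Δ k)⁻¹ * ‖D k‖ ≤ 2 / σ := by
          calc (σ * Δ k)⁻¹ * ‖D k‖ ≤ (σ * Δ k)⁻¹ * (2 * Δ k) := by gcongr; exact hD k
            _ = 2 / σ := by field_simp
        calc ((σ * Δ k)⁻¹ * ‖D k‖) ^ 2 ≤ (2 / σ) ^ 2 := by gcongr
          _ = _ := by rw [div_pow]; norm_num
    · have : IsEmpty (Fin (N.layer k).paramDim) := by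
        rw [not_not] at h
        rw [h]
        infer_instance
      simp
  calc _ ≤ ∑ k, if (N.layer k).paramDim ≠ 0 then 4 / σ ^ 2 else 0 :=
        Finset.sum_le_sum fun k _ => h1 k
    _ = _ := by
      rw [← Finset.sum_filter, Finset.sum_const, nsmul_eq_mul]
      ring

/-! ### One iteration -/

variable {Y : Type*} {X₁ : ℝ} {n : ℕ} (ℓ : Vec (N.dim N.K) → Y → ℝ) (l : ℝ≥0)

/-- The sum of the gradients over a batch. -/
noncomputable def gradSum (Z : Fin n → Instance (N.dim 0) X₁ Y) (θ : N.Params)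
    (V : Finset (Fin n)) : N.Params :=
  fun k => ∑ i ∈ V, N.lossGrad ℓ θ (Z i).1.1 (Z i).2 k

/-- The scalar coordinates of the sum of the gradients over a batch, in units of the standard
deviation of the noise. -/
noncomputable def scaledGradSum (c : Fin N.K → ℝ) (Z : Fin n → Instance (N.dim 0) X₁ Y)
    (θ : N.Params) (V : Finset (Fin n)) (p : N.ParamIndex) : ℝ :=
  (c p.1)⁻¹ * N.gradSum ℓ Z θ V p.1 p.2

/-- The gradient step as a function of the noisy sum of the gradients, given in units of the
standard deviation of the noise. -/
noncomputable def applyNoisy (lr w : ℝ) (c : Fin N.K → ℝ) (θ : N.Params)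
    (ξ : N.ParamIndex → ℝ) : N.Params :=
  fun k => θ k - lr • ((1 / w) • (c k • N.unflatten ξ k))

theorem measurable_applyNoisy (lr w : ℝ) (c : Fin N.K → ℝ) (θ : N.Params) :
    Measurable (N.applyNoisy lr w c θ) :=
  measurable_pi_lambda _ fun k => ((((measurable_pi_apply k).comp
    (N.measurable_smul_unflatten c)).const_smul (1 / w)).const_smul lr).const_sub (θ k)

theorem measurable_update (lr : ℝ) (Z : Fin n → Instance (N.dim 0) X₁ Y) (θ : N.Params)
    (V : Finset (Fin n)) : Measurable (N.update ℓ lr Z θ V) :=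
  measurable_pi_lambda _ fun k => by
    have h : Measurable fun b : N.Params => b k := measurable_pi_apply k
    exact (((h.const_add (∑ i ∈ V, N.lossGrad ℓ θ (Z i).1.1 (Z i).2 k)).const_smul
      (1 / (V.card : ℝ))).const_smul lr).const_sub (θ k)

/-- Writing `g + c ξ = c (c⁻¹ g + ξ)` isolates the data in the mean of a standard Gaussian; the
remaining map depends on the batch only through its size. In a layer without noise (`c = 0`) this
needs `g = 0`. -/
theorem map_update_noise (σ lr : ℝ) (Δ : Fin N.K → ℝ) (Z : Fin n → Instance (N.dim 0) X₁ Y)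
    (θ : N.Params) (V : Finset (Fin n)) (h : ∀ k, σ * Δ k = 0 → N.gradSum ℓ Z θ V k = 0) :
    (N.noise σ Δ).map (N.update ℓ lr Z θ V) =
      ((stdGauss N.ParamIndex).map
        (N.scaledGradSum ℓ (fun k => σ * Δ k) Z θ V + ·)).map
          (N.applyNoisy lr V.card (fun k => σ * Δ k) θ) := by
  have hm := N.measurable_smul_unflatten fun k => σ * Δ k
  rw [noise_eq_map, Measure.map_map (N.measurable_update ℓ lr Z θ V) hm,
    Measure.map_map (N.measurable_applyNoisy _ _ _ _) (measurable_const_add _)]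
  congr 1
  funext ξ k
  simp only [Function.comp_apply, update, applyNoisy]
  congr 3
  ext j
  simp only [unflatten, scaledGradSum, PiLp.add_apply, PiLp.smul_apply, smul_eq_mul, Pi.add_apply,
    mul_add]
  congr 1
  by_cases hc : σ * Δ k = 0
  · rw [hc, zero_mul]
    exact congrArg (fun v : Vec _ => v j) (h k hc)
  · rw [mul_inv_cancel_left₀ hc]
    rfl

variable {ℓ l}

theorem norm_lossGrad_sub_le (hℓ : ∀ y, LipschitzWith l (fun v => ℓ v y)) {C : ℝ} (hC : 0 ≤ C)
    (θ : N.Params) (z z' : Instance (N.dim 0) X₁ Y) (k : Fin N.K) :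
    ‖N.lossGrad ℓ (N.clipParams C θ) z.1.1 z.2 k -
      N.lossGrad ℓ (N.clipParams C θ) z'.1.1 z'.2 k‖ ≤
      2 * N.layerSensitivity (N.clipNorms C θ) X₁ l k := by
  have h : ∀ z : Instance (N.dim 0) X₁ Y, ‖N.lossGrad ℓ (N.clipParams C θ) z.1.1 z.2 k‖ ≤
      N.layerSensitivity (N.clipNorms C θ) X₁ l k := fun z =>
    N.norm_lossGrad_le hℓ (pnorm_clipParams_le hC θ) z.1.2 z.2 k
  refine (norm_sub_le _ _).trans ?_
  linarith [h z, h z']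

theorem gradSum_eq_zero (hℓ : ∀ y, LipschitzWith l (fun v => ℓ v y)) {C σ : ℝ} (hC : 0 ≤ C)
    (hσ : 0 < σ) (Z : Fin n → Instance (N.dim 0) X₁ Y) (θ : N.Params) (V : Finset (Fin n))
    (k : Fin N.K) (h : σ * N.layerSensitivity (N.clipNorms C θ) X₁ l k = 0) :
    N.gradSum ℓ Z (N.clipParams C θ) V k = 0 := by
  refine Finset.sum_eq_zero fun i _ => ?_
  have := N.norm_lossGrad_le hℓ (pnorm_clipParams_le hC θ) (Z i).1.2 (Z i).2 k
  rwa [(mul_eq_zero_iff_left hσ.ne').1 h, norm_le_zero_iff] at this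

theorem sum_sq_scaledGradSum_sub_le (hℓ : ∀ y, LipschitzWith l (fun v => ℓ v y)) {C σ : ℝ}
    (hC : 0 ≤ C) (hσ : 0 < σ) (θ : N.Params) {Z Z' : Fin n → Instance (N.dim 0) X₁ Y}
    {V V' : Finset (Fin n)} {z z' : Instance (N.dim 0) X₁ Y}
    (h : ∀ k, N.gradSum ℓ Z (N.clipParams C θ) V k - N.gradSum ℓ Z' (N.clipParams C θ) V' k =
      N.lossGrad ℓ (N.clipParams C θ) z.1.1 z.2 k -
        N.lossGrad ℓ (N.clipParams C θ) z'.1.1 z'.2 k) :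
    ∑ p, (N.scaledGradSum ℓ (fun k => σ * N.layerSensitivity (N.clipNorms C θ) X₁ l k) Z
        (N.clipParams C θ) V p -
      N.scaledGradSum ℓ (fun k => σ * N.layerSensitivity (N.clipNorms C θ) X₁ l k) Z'
        (N.clipParams C θ) V' p) ^ 2 ≤ gaussRatioSq N.numTrainable σ := by
  simp only [scaledGradSum, ← mul_sub]
  refine N.sum_sq_le_gaussRatioSq hσ
    (N.layerSensitivity_nonneg (N.clipNorms C θ) X₁ l.coe_nonneg)
    (N.gradSum ℓ Z (N.clipParams C θ) V - N.gradSum ℓ Z' (N.clipParams C θ) V') fun k => ?_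
  rw [Pi.sub_apply, h k]
  exact N.norm_lossGrad_sub_le hℓ hC θ z z' k

theorem gradSum_congr {Z Z' : Fin n → Instance (N.dim 0) X₁ Y} {V : Finset (Fin n)}
    (h : ∀ i ∈ V, Z i = Z' i) (θ : N.Params) : N.gradSum ℓ Z θ V = N.gradSum ℓ Z' θ V :=
  funext fun _ => Finset.sum_congr rfl fun i hi => by rw [h i hi]

theorem gradSum_sub_of_mem {Z Z' : Fin n → Instance (N.dim 0) X₁ Y} {i : Fin n}
    (hZ : ∀ j, j ≠ i → Z j = Z' j) {V : Finset (Fin n)} (hi : i ∈ V) (θ : N.Params)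
    (k : Fin N.K) :
    N.gradSum ℓ Z θ V k - N.gradSum ℓ Z' θ V k =
      N.lossGrad ℓ θ (Z i).1.1 (Z i).2 k - N.lossGrad ℓ θ (Z' i).1.1 (Z' i).2 k := by
  rw [gradSum, gradSum, ← Finset.add_sum_erase _ _ hi, ← Finset.add_sum_erase V _ hi,
    Finset.sum_congr rfl fun j hj => by rw [hZ j (Finset.ne_of_mem_erase hj)],
    add_sub_add_right_eq_sub]

theorem gradSum_sub_insert_erase (Z : Fin n → Instance (N.dim 0) X₁ Y) {i j : Fin n}
    {V : Finset (Fin n)} (hi : i ∈ V) (hj : j ∉ V) (θ : N.Params) (k : Fin N.K) :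
    N.gradSum ℓ Z θ V k - N.gradSum ℓ Z θ (insert j (V.erase i)) k =
      N.lossGrad ℓ θ (Z i).1.1 (Z i).2 k - N.lossGrad ℓ θ (Z j).1.1 (Z j).2 k := by
  rw [gradSum, gradSum, ← Finset.add_sum_erase _ _ hi,
    Finset.sum_insert fun e => hj (Finset.mem_of_mem_erase e), add_sub_add_right_eq_sub]

variable {C σ s lr : ℝ}

theorem step_eq (hℓ : ∀ y, LipschitzWith l (fun v => ℓ v y)) (hC : 0 ≤ C) (hσ : 0 < σ)
    (Z : Fin n → Instance (N.dim 0) X₁ Y) (θ : N.Params) :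
    N.step ℓ l C σ s lr Z θ = ∑ V ∈ batches n, ENNReal.ofReal (batchProb n (s / n) V) •
      ((stdGauss N.ParamIndex).map (N.scaledGradSum ℓ
        (fun k => σ * N.layerSensitivity (N.clipNorms C θ) X₁ l k) Z (N.clipParams C θ) V + ·)).map
          (N.applyNoisy lr V.card (fun k => σ * N.layerSensitivity (N.clipNorms C θ) X₁ l k)
            (N.clipParams C θ)) :=
  Finset.sum_congr rfl fun V _ => by
    rw [N.map_update_noise ℓ σ lr _ Z _ V (N.gradSum_eq_zero hℓ hC hσ Z θ V)]

theorem momentBound_step_gaussian (hℓ : ∀ y, LipschitzWith l (fun v => ℓ v y)) (hC : 0 ≤ C)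
    (hσ : 0 < σ) (hn : n ≠ 0) (hq : 0 < s / n) (hq1 : s / n ≤ 1)
    {Z Z' : Fin n → Instance (N.dim 0) X₁ Y} (hZ : Adjacent Z Z') (θ : N.Params) (b : ℕ) :
    MomentBound b (N.step ℓ l C σ s lr Z θ) (N.step ℓ l C σ s lr Z' θ)
      (ENNReal.ofReal (Real.exp (b * ((b + 1) * gaussRatioSq N.numTrainable σ / 2)))) := by
  obtain ⟨i, hi⟩ := hZ
  rw [N.step_eq hℓ hC hσ, N.step_eq hℓ hC hσ]
  refine (MomentBound.sum _ fun V _ => (MomentBound.map (MomentBound.gaussian b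
    (r := gaussRatioSq N.numTrainable σ) ?_) (N.measurable_applyNoisy _ _ _ _)).smul
    (ENNReal.ofReal (batchProb n (s / n) V))).mono (le_of_eq ?_)
  · by_cases h : i ∈ V
    · exact N.sum_sq_scaledGradSum_sub_le hℓ hC hσ θ fun k => N.gradSum_sub_of_mem hi h _ k
    · simp only [scaledGradSum]
      rw [N.gradSum_congr fun j hj => hi j fun e => h (e ▸ hj)]
      simpa using gaussRatioSq_nonneg _ _
  · rw [← Finset.sum_mul, sum_ofReal_batchProb hn hq hq1, one_mul]

theorem momentBound_step_subsampled (hℓ : ∀ y, LipschitzWith l (fun v => ℓ v y)) (hC : 0 ≤ C)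
    (hσ : 0 < σ) (hq : 0 ≤ s / n) (hq1 : s / n ≤ 1)
    {Z Z' : Fin n → Instance (N.dim 0) X₁ Y} (hZ : Adjacent Z Z') (θ : N.Params) {b : ℕ}
    (hb : b ≠ 0) :
    MomentBound b (N.step ℓ l C σ s lr Z θ) (N.step ℓ l C σ s lr Z' θ)
      (∑ V ∈ batches n, ENNReal.ofReal (batchProb n (s / n) V) * ENNReal.ofReal
        (subsampledMoment (gaussRatioSq N.numTrainable σ) ((V.card : ℝ) / n) (b + 1))) := by
  obtain ⟨i, hi⟩ := hZ
  rw [N.step_eq hℓ hC hσ, N.step_eq hℓ hC hσ]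
  refine MomentBound.batches hq hq1 i
    (A := fun p => ENNReal.ofReal (subsampledMoment (gaussRatioSq N.numTrainable σ) p (b + 1)))
    (fun V hV j hj => ?_) ?_
  · have hmap : ∀ (c d : ℝ≥0∞) (P Q : Measure (N.ParamIndex → ℝ))
        (f : (N.ParamIndex → ℝ) → N.Params), Measurable f →
        c • P.map f + d • Q.map f = (c • P + d • Q).map f := by
      intro c d P Q f hf
      rw [Measure.map_add _ _ hf, Measure.map_smul, Measure.map_smul]
    have hWZ : ∀ j' ∈ insert j (V.erase i), Z' j' = Z j' := fun j' hj' => by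
      refine (hi j' fun e => ?_).symm
      rw [e, Finset.mem_insert] at hj'
      rcases hj' with h | h
      · exact hj (h ▸ hV)
      · exact Finset.notMem_erase i V h
    have hW : N.scaledGradSum ℓ (fun k => σ * N.layerSensitivity (N.clipNorms C θ) X₁ l k) Z'
        (N.clipParams C θ) (insert j (V.erase i)) =
        N.scaledGradSum ℓ (fun k => σ * N.layerSensitivity (N.clipNorms C θ) X₁ l k) Z
        (N.clipParams C θ) (insert j (V.erase i)) := by
      funext p
      rw [scaledGradSum, scaledGradSum, N.gradSum_congr hWZ]
    -- The two batches of a pair have equal size, so they share the same post-processing map and the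
    -- mixture can be formed before it. The swapped batch avoids `i`, so its mean is the same for
    -- `Z` and `Z'`.
    rw [card_insert_erase hV hj, hW, hmap _ _ _ _ _ (N.measurable_applyNoisy _ _ _ _),
      hmap _ _ _ _ _ (N.measurable_applyNoisy _ _ _ _)]
    refine MomentBound.map (MomentBound.subsampled hb (by positivity) ?_ ?_ ?_ ?_)
      (N.measurable_applyNoisy _ _ _ _)
    · exact div_le_one_of_le₀ (by exact_mod_cast by simpa using V.card_le_univ) (by positivity)
    · exact N.sum_sq_scaledGradSum_sub_le hℓ hC hσ θ fun k => N.gradSum_sub_of_mem hi hV _ k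
    · exact N.sum_sq_scaledGradSum_sub_le hℓ hC hσ θ fun k =>
        N.gradSum_sub_insert_erase Z hV hj _ k
    · rw [← hW]
      exact N.sum_sq_scaledGradSum_sub_le hℓ hC hσ θ fun k =>
        N.gradSum_sub_insert_erase Z' hV hj _ k
  · have h0 := gaussRatioSq_nonneg N.numTrainable σ
    have h1 := N.sum_sq_scaledGradSum_sub_le hℓ hC hσ θ fun k =>
      N.gradSum_sub_of_mem (ℓ := ℓ) hi (Finset.mem_univ i) (N.clipParams C θ) k
    -- For the full batch `p = 1`; the third Gaussian has weight 0 and is taken equal to the second.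
    have h2 := MomentBound.subsampled hb zero_le_one le_rfl h1 h1 (by simpa using h0)
    simp only [ENNReal.ofReal_one, one_smul, sub_self, ENNReal.ofReal_zero, zero_smul,
      add_zero] at h2
    exact h2.map (N.measurable_applyNoisy _ _ _ _)

theorem momentBound_step (hℓ : ∀ y, LipschitzWith l (fun v => ℓ v y)) (hC : 0 ≤ C)
    (hσ : 0 < σ) (hn : n ≠ 0) (hq : 0 < s / n) (hq1 : s / n ≤ 1)
    {Z Z' : Fin n → Instance (N.dim 0) X₁ Y} (hZ : Adjacent Z Z') (θ : N.Params) {b : ℕ}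
    (hb : b ≠ 0) :
    MomentBound b (N.step ℓ l C σ s lr Z θ) (N.step ℓ l C σ s lr Z' θ)
      (ENNReal.ofReal (Real.exp (b * stepRDP N.numTrainable n σ s (b + 1)))) := by
  have hb' : (0 : ℝ) < b := by positivity
  rw [stepRDP]
  rcases min_choice (((b + 1 : ℕ) : ℝ) * gaussRatioSq N.numTrainable σ / 2)
    (Real.log (∑ V ∈ batches n, batchProb n (s / n) V *
      subsampledMoment (gaussRatioSq N.numTrainable σ) ((V.card : ℝ) / n) (b + 1)) /
        (((b + 1 : ℕ) : ℝ) - 1)) with h | h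
  · rw [h]
    push_cast
    exact N.momentBound_step_gaussian hℓ hC hσ hn hq hq1 hZ θ b
  · rw [h]
    refine (N.momentBound_step_subsampled hℓ hC hσ hq.le hq1 hZ θ hb).mono (le_of_eq ?_)
    have hA : ∀ V : Finset (Fin n),
        1 ≤ subsampledMoment (gaussRatioSq N.numTrainable σ) ((V.card : ℝ) / n) (b + 1) :=
      fun V => one_le_subsampledMoment (gaussRatioSq_nonneg _ _) (by positivity) hb
    have hP := fun V : Finset (Fin n) => batchProb_nonneg hq.le hq1 V
    -- The averaged moment must be positive for `exp` to undo `log`.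
    have hM : 1 ≤ ∑ V ∈ batches n, batchProb n (s / n) V *
        subsampledMoment (gaussRatioSq N.numTrainable σ) ((V.card : ℝ) / n) (b + 1) := by
      rw [← sum_batchProb hn hq hq1]
      exact Finset.sum_le_sum fun V _ => le_mul_of_one_le_right (hP V) (hA V)
    push_cast
    rw [add_sub_cancel_right, mul_div_cancel₀ _ hb'.ne', Real.exp_log (by linarith),
      ENNReal.ofReal_sum_of_nonneg fun V _ => mul_nonneg (hP V) (by linarith [hA V])]
    exact Finset.sum_congr rfl fun V _ => (ENNReal.ofReal_mul (hP V)).symm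

/-- The noise scale varies with `θ`. Expressing each batch's contribution through one fixed Gaussian
and a jointly measurable map reduces the claim to measurability of the measures of sections. -/
theorem measurable_step (hℓ : ∀ y, LipschitzWith l (fun v => ℓ v y))
    (Z : Fin n → Instance (N.dim 0) X₁ Y) : Measurable (N.step ℓ l C σ s lr Z) := by
  refine Measure.measurable_of_measurable_coe _ fun S hS => ?_
  set H : Finset (Fin n) → N.Params × (N.ParamIndex → ℝ) → N.Params := fun V q =>
    N.update ℓ lr Z (N.clipParams C q.1) V
      fun k => (σ * N.layerSensitivity (N.clipNorms C q.1) X₁ l k) • N.unflatten q.2 k with hH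
  have hHm : ∀ V, Measurable (H V) := by
    intro V
    refine measurable_pi_lambda _ fun k => ?_
    have h1 : Measurable fun q : N.Params × (N.ParamIndex → ℝ) => N.clipParams C q.1 :=
      (N.measurable_clipParams C).comp measurable_fst
    have h2 : Measurable fun q : N.Params × (N.ParamIndex → ℝ) =>
        σ * N.layerSensitivity (N.clipNorms C q.1) X₁ l k :=
      ((N.measurable_layerSensitivity X₁ l k).comp
        ((N.measurable_clipNorms C).comp measurable_fst)).const_mul σ
    have h3 : Measurable fun q : N.Params × (N.ParamIndex → ℝ) => N.unflatten q.2 k :=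
      (measurable_pi_apply k).comp (N.measurable_unflatten.comp measurable_snd)
    have h4 : Measurable fun q : N.Params × (N.ParamIndex → ℝ) =>
        ∑ i ∈ V, N.lossGrad ℓ (N.clipParams C q.1) (Z i).1.1 (Z i).2 k :=
      Finset.measurable_fun_sum _ fun i _ => (N.measurable_lossGrad hℓ _ _ k).comp h1
    exact ((measurable_pi_apply k).comp h1).sub
      (((h4.add (h2.smul h3)).const_smul (1 / (V.card : ℝ))).const_smul lr)
  have heq : ∀ θ, N.step ℓ l C σ s lr Z θ S =
      ∑ V ∈ batches n, ENNReal.ofReal (batchProb n (s / n) V) *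
        stdGauss N.ParamIndex (Prod.mk θ ⁻¹' (H V ⁻¹' S)) := by
    intro θ
    rw [step, Measure.finsetSum_apply]
    refine Finset.sum_congr rfl fun V _ => ?_
    have hm := N.measurable_smul_unflatten fun k =>
      σ * N.layerSensitivity (N.clipNorms C θ) X₁ l k
    rw [Measure.smul_apply, smul_eq_mul, noise_eq_map,
      Measure.map_map (N.measurable_update ℓ lr Z _ V) hm, Measure.map_apply
        ((N.measurable_update ℓ lr Z _ V).comp hm) hS]
    rfl
  simp only [heq]
  exact Finset.measurable_fun_sum _ fun V _ =>
    (measurable_measure_prodMk_left (hHm V hS)).const_mul _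

theorem isProbabilityMeasure_step (hn : n ≠ 0) (hq : 0 < s / n) (hq1 : s / n ≤ 1)
    (Z : Fin n → Instance (N.dim 0) X₁ Y) (θ : N.Params) :
    IsProbabilityMeasure (N.step ℓ l C σ s lr Z θ) := by
  constructor
  rw [step, Measure.finsetSum_apply, ← sum_ofReal_batchProb hn hq hq1]
  refine Finset.sum_congr rfl fun V _ => ?_
  have hprob : IsProbabilityMeasure (N.noise σ (N.layerSensitivity (N.clipNorms C θ) X₁ l)) := by
    rw [noise_eq_map]
    exact Measure.isProbabilityMeasure_map (N.measurable_smul_unflatten fun k =>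
      σ * N.layerSensitivity (N.clipNorms C θ) X₁ l k).aemeasurable
  have := Measure.isProbabilityMeasure_map
    (μ := N.noise σ (N.layerSensitivity (N.clipNorms C θ) X₁ l))
    (N.measurable_update ℓ lr Z (N.clipParams C θ) V).aemeasurable
  rw [Measure.smul_apply, measure_univ, smul_eq_mul, mul_one]

/-! ### The algorithm -/

variable {η : ℕ → ℝ} {init : Measure N.Params} [IsProbabilityMeasure init]

theorem isProbabilityMeasure_iterate (hℓ : ∀ y, LipschitzWith l (fun v => ℓ v y)) (hn : n ≠ 0)
    (hq : 0 < s / n) (hq1 : s / n ≤ 1) (Z : Fin n → Instance (N.dim 0) X₁ Y) (T : ℕ) :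
    IsProbabilityMeasure (N.iterate ℓ l C σ s η init Z T) := by
  induction T with
  | zero => assumption
  | succ T ih =>
    constructor
    have hst := fun θ => N.isProbabilityMeasure_step (ℓ := ℓ) (l := l) (C := C) (σ := σ)
      (lr := η (T + 1)) hn hq hq1 Z θ
    rw [iterate, Measure.bind_apply .univ (N.measurable_step hℓ Z).aemeasurable]
    simp

theorem isProbabilityMeasure_lipDPSGD (hℓ : ∀ y, LipschitzWith l (fun v => ℓ v y)) (hn : n ≠ 0)
    (hq : 0 < s / n) (hq1 : s / n ≤ 1) (Z : Fin n → Instance (N.dim 0) X₁ Y) (T : ℕ) :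
    IsProbabilityMeasure (N.lipDPSGD ℓ l C σ s η init T Z) := by
  have := N.isProbabilityMeasure_iterate (C := C) (σ := σ) (η := η) (init := init) hℓ hn hq hq1 Z T
  exact Measure.isProbabilityMeasure_map (N.measurable_clipParams C).aemeasurable

theorem momentBound_iterate (hℓ : ∀ y, LipschitzWith l (fun v => ℓ v y)) (hC : 0 ≤ C)
    (hσ : 0 < σ) (hn : n ≠ 0) (hq : 0 < s / n) (hq1 : s / n ≤ 1)
    {Z Z' : Fin n → Instance (N.dim 0) X₁ Y} (hZ : Adjacent Z Z') {b : ℕ} (hb : b ≠ 0) (T : ℕ) :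
    MomentBound b (N.iterate ℓ l C σ s η init Z T) (N.iterate ℓ l C σ s η init Z' T)
      (ENNReal.ofReal (Real.exp (b * (T * stepRDP N.numTrainable n σ s (b + 1))))) := by
  induction T with
  | zero => simpa [iterate] using MomentBound.self (P := init)
  | succ T ih =>
    have := ih.bind (N.measurable_step (C := C) (σ := σ) (s := s) (lr := η (T + 1)) hℓ Z)
      (N.measurable_step hℓ Z') fun θ => N.momentBound_step hℓ hC hσ hn hq hq1 hZ θ hb
    rw [← ENNReal.ofReal_mul (Real.exp_nonneg _), ← Real.exp_add] at this
    have hT : (b : ℝ) * ((T + 1 : ℕ) * stepRDP N.numTrainable n σ s (b + 1)) =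
        b * (T * stepRDP N.numTrainable n σ s (b + 1)) +
          b * stepRDP N.numTrainable n σ s (b + 1) := by
      push_cast
      ring
    rw [hT]
    exact this

theorem isDP_lipDPSGD (hℓ : ∀ y, LipschitzWith l (fun v => ℓ v y)) (hC : 0 ≤ C)
    (hσ : 0 < σ) (hn : n ≠ 0) (hq : 0 < s / n) (hq1 : s / n ≤ 1) (T : ℕ) {b : ℕ} (hb : b ≠ 0)
    {ε δ : ℝ} (hδ : 0 < δ)
    (hε : T * stepRDP N.numTrainable n σ s (b + 1) + Real.log (1 / δ) / b ≤ ε) :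
    IsDP (fun Z : Fin n → Instance (N.dim 0) X₁ Y => N.lipDPSGD ℓ l C σ s η init T Z) ε δ := by
  intro Z Z' hZ S hS
  have h1 := fun Z : Fin n → Instance (N.dim 0) X₁ Y =>
    N.isProbabilityMeasure_lipDPSGD (C := C) (σ := σ) (η := η) (init := init) hℓ hn hq hq1 Z T
  exact ((N.momentBound_iterate hℓ hC hσ hn hq hq1 hZ hb T).map
    (N.measurable_clipParams C)).measure_le hb hδ le_rfl hε hS
    (measure_ne_top (N.lipDPSGD ℓ l C σ s η init T Z) S)
    (measure_ne_top (N.lipDPSGD ℓ l C σ s η init T Z') S)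

end Network

/-- The value `(b + 1) c + L / b` of the accountant is at most `ε` for some integer `b`. -/
theorem exists_order {c ε L : ℝ} (hc : 4 * c * (ε + L) ≤ ε ^ 2) (hε : 0 < ε)
    (hL : 0 < L) : ∃ b : ℕ, b ≠ 0 ∧ (b + 1) * c + L / b ≤ ε := by
  -- In the extremal case `4 c (ε + L) = ε²` the goal, multiplied by `b`, is the quadratic
  -- inequality `(b ε - (2 L + 3 ε / 2))² ≤ 2 L ε + 9 ε² / 4`. Its vertex is `y`, and it holds
  -- within distance `3/2` of `y`, hence at `⌊y⌋`; the summand `3/2` also ensures `⌊y⌋ ≥ 1`.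
  set y := 2 * L / ε + 3 / 2 with hy
  have hy0 : 0 < 2 * L / ε := by positivity
  have hfl := Nat.floor_le (show 0 ≤ y by positivity)
  have hlt := Nat.lt_floor_add_one y
  have hb1 : 1 ≤ ⌊y⌋₊ := Nat.le_floor (by push_cast; linarith)
  refine ⟨⌊y⌋₊, by omega, ?_⟩
  have hb : (1 : ℝ) ≤ ⌊y⌋₊ := by exact_mod_cast hb1
  set b : ℝ := (⌊y⌋₊ : ℝ)
  have hbε : |b * ε - (2 * L + 3 / 2 * ε)| ≤ ε := by
    have : y * ε = 2 * L + 3 / 2 * ε := by rw [hy]; field_simp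
    rw [← this, abs_le]
    constructor <;> nlinarith
  have hq : (b * ε - (2 * L + 3 / 2 * ε)) ^ 2 ≤ ε ^ 2 :=
    sq_le_sq' (abs_le.1 hbε).1 (abs_le.1 hbε).2
  have h2 : (b + 1) * c * (4 * (ε + L)) ≤ (b + 1) * ε ^ 2 := by nlinarith
  have key : (b + 1) * ε ^ 2 * b + L * (4 * (ε + L)) ≤ ε * b * (4 * (ε + L)) := by
    nlinarith [mul_pos hε hL]
  have hb0 : 0 < b := by linarith
  have h3 : ((b + 1) * c * b + L) * (4 * (ε + L)) ≤ ε * b * (4 * (ε + L)) := by nlinarith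
  have h4 : (b + 1) * c * b + L ≤ ε * b := le_of_mul_le_mul_right h3 (by positivity)
  rw [← sub_nonneg] at h4 ⊢
  have : ε - ((b + 1) * c + L / b) = (ε * b - ((b + 1) * c * b + L)) / b := by
    field_simp
  rw [this]
  positivity

end LipDPSGD

/-! ### The three guarantees. -/

theorem mainTheorem1
    -- a feed-forward network of Lipschitz layers, labels, a Lipschitz loss
    (N : LipDPSGD.Network) {Y : Type*}
    (ℓ : LipDPSGD.Vec (N.dim N.K) → Y → ℝ) (l : ℝ≥0)
    (hℓ : ∀ y, LipschitzWith l (fun v => ℓ v y))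
    -- the bound on the input norm, the size of the datasets, the batch size
    (X₁ : ℝ) (n : ℕ) (s : ℝ) (hs : 1 ≤ s) (hsn : s ≤ n)
    -- maximal parameter norm, learning rates, number of iterations, random initialization
    (C : ℝ) (hC : 0 < C) (η : ℕ → ℝ) (T : ℕ)
    (init : Measure N.Params) [IsProbabilityMeasure init]
    -- noise multiplier
    (σ : ℝ) (hσ : 0 < σ) :
    -- the algorithm is well defined: its output is a random parameter vector
    (∀ Z : Fin n → LipDPSGD.Instance (N.dim 0) X₁ Y,
      IsProbabilityMeasure (N.lipDPSGD ℓ l C σ s η init T Z)) ∧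
    -- privacy level computed by the accountant
    (∀ (a : ℕ) (δ : ℝ), 2 ≤ a → 0 < δ → δ < 1 →
      LipDPSGD.IsDP
        (fun Z : Fin n → LipDPSGD.Instance (N.dim 0) X₁ Y =>
          N.lipDPSGD ℓ l C σ s η init T Z)
        (LipDPSGD.accountant N.numTrainable n T σ s a δ) δ) ∧
    -- every target privacy level is attained if the noise multiplier is large enough
    (∀ ε δ : ℝ, 0 < ε → 0 < δ → δ < 1 →
      8 * N.numTrainable * T * (ε + Real.log (1 / δ)) / ε ^ 2 ≤ σ ^ 2 →
      LipDPSGD.IsDP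
        (fun Z : Fin n → LipDPSGD.Instance (N.dim 0) X₁ Y =>
          N.lipDPSGD ℓ l C σ s η init T Z) ε δ) := by
  have hn0 : (0 : ℝ) < n := by linarith
  have hn : n ≠ 0 := by rintro rfl; simp at hn0
  have hq : 0 < s / n := div_pos (by linarith) hn0
  have hq1 : s / n ≤ 1 := (div_le_one hn0).2 hsn
  refine ⟨fun Z => N.isProbabilityMeasure_lipDPSGD hℓ hn hq hq1 Z T, fun a δ ha hδ _ => ?_,
    fun ε δ hε hδ hδ1 hσε => ?_⟩
  · obtain ⟨b, rfl⟩ : ∃ b, a = b + 1 := ⟨a - 1, by omega⟩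
    refine N.isDP_lipDPSGD hℓ hC.le hσ hn hq hq1 T (b := b) (by omega) hδ (le_of_eq ?_)
    rw [LipDPSGD.accountant]
    push_cast
    rw [add_sub_cancel_right]
  · have hL : 0 < Real.log (1 / δ) := Real.log_pos (by rw [lt_div_iff₀ hδ]; linarith)
    -- `c` is `T r / 2` with `r = 4m/σ²`, so `(b + 1) c` is the unamplified Rényi cost of `T`
    -- iterations at order `b + 1`.
    obtain ⟨b, hb, hbε⟩ := LipDPSGD.exists_order (c := 2 * N.numTrainable * T / σ ^ 2) (ε := ε)
      (L := Real.log (1 / δ)) (by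
        rw [div_le_iff₀ (by positivity)] at hσε
        rw [mul_div_assoc', div_mul_eq_mul_div, div_le_iff₀ (by positivity)]
        linarith) hε hL
    refine N.isDP_lipDPSGD hℓ hC.le hσ hn hq hq1 T hb hδ (le_trans ?_ hbε)
    refine add_le_add ?_ le_rfl
    calc (T : ℝ) * LipDPSGD.stepRDP N.numTrainable n σ s (b + 1)
        ≤ T * (((b + 1 : ℕ) : ℝ) * LipDPSGD.gaussRatioSq N.numTrainable σ / 2) := by
          gcongr
          exact min_le_left _ _
      _ = _ := by
          rw [LipDPSGD.gaussRatioSq]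
          push_cast
          ring
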